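/- Let $\Omega=[0,2\pi]^2$ with periodic boundary conditions, let $\widehat f(k)=(2\pi)^{-2}\int_\Omega f(x)e^{-ik\cdot x}\,dx$ for $k\in\mathbb Z^2$, and let $\|f\|_s=\big(\sum_{k}|k|^{2s}|\widehat f(k)|^2\big)^{1/2}$; for $s>0$ let $H^s$ be the space of real-valued $f\in L^2(\Omega)$ with $\|f\|_s<\infty$. For $\mu>0$ consider the initial value problem for the regularized quasi-geostrophic equation $$\theta_t+u\cdot\nabla\theta+\mu(-\Delta)^{\alpha}\theta_t=0,\qquad u=(-\mathcal R_2\theta,\mathcal R_1\theta),\qquad \theta(\cdot,0)=\theta_0,$$ where $(-\Delta)^\alpha$ has Fourier symbol $|k|^{2\alpha}$ and the Riesz transform $\mathcal R_j$ has Fourier symbol $-ik_j/|k|$ for $k\ne0$ and $0$ for $k=0$. For $s>1$, a solution in $L^\infty([0,T];H^s)$ is a function $\theta:[0,T]\to L^2(\Omega)$, strongly measurable in $t$, with $\operatorname{ess\,sup}_{0\le t\le T}\|\theta(\cdot,t)\|_s<\infty$ and $\theta(\cdot,0)=\theta_0$, such that for every $k\in\mathbb Z^2$ the function $\tau\mapsto\widehat{u\cdot\nabla\theta}(k,\tau)$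 is integrable on $[0,T]$ and, for every $t\in[0,T]$, $$(1+\mu|k|^{2\alpha})\big(\widehat\theta(k,t)-\widehat{\theta_0}(k)\big)+\int_0^t\widehat{u\cdot\nabla\theta}(k,\tau)\,d\tau=0 .$$ Let $\mu>0$, $\alpha\ge\frac12$ and $s>1$. (a) There is a function $b\mapsto T(b)>0$ on $[0,\infty)$ (depending only on $\mu,\alpha,s$) such that for every $\theta_0\in H^s$ the initial value problem has a unique solution $\theta\in L^\infty([0,T];H^s)$ with $T=T(\|\theta_0\|_s)$. (b) Let $\theta_0\in H^s$ and let $T_*\in(0,\infty]$ be the supremum of all $T>0$ for which the initial value problem has a solution in $L^\infty([0,T];H^s)$. Then there is a function $\theta$ on $[0,T_*)$ that is a solution in $L^\infty([0,T];H^s)$ for every $0<T<T_*$, and every solution in $L^\infty([0,T];H^s)$, for any $T>0$, agrees with it on $[0,T)$. Moreover, either $T_*=\infty$ or $$\limsup_{t\uparrow T_*}\|\theta(\cdot,t)\|_s=\infty .$$ -/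

import Mathlib

open MeasureTheory Set Filter Topology
open scoped ENNReal NNReal Real

namespace RQG

instance factTwoPiPos : Fact (0 < 2 * π) := ⟨Real.two_pi_pos⟩

/-- The period box `[0, 2π]²` with opposite sides identified, i.e. the torus `(ℝ / 2πℤ)²`.
Its `volume` is Lebesgue measure, of total mass `(2π)²`. -/
abbrev Torus : Type := Fin 2 → AddCircle (2 * π)

/-- Real-valued square integrable periodic functions (up to a.e. equality). -/
abbrev L2 : Type := Lp ℝ 2 (volume : Measure Torus)

/-- The plane wave `x ↦ exp (i k·x) = exp (i k₁ x₁) exp (i k₂ x₂)`. -/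
noncomputable def wave (k : Fin 2 → ℤ) : C(Torus, ℂ) where
  toFun x := ∏ j, fourier (k j) (x j)
  continuous_toFun := by fun_prop

/-- The Fourier coefficient `(2π)⁻² ∫ g(x) exp (-i k·x) dx`. -/
noncomputable def coeff (g : Torus → ℂ) (k : Fin 2 → ℤ) : ℂ :=
  (1 / (2 * π : ℂ) ^ 2) * ∫ x, g x * wave (-k) x

/-- The Fourier coefficient of a real-valued `L²` function. -/
noncomputable def hat (f : L2) (k : Fin 2 → ℤ) : ℂ :=
  coeff (fun x => ((f x : ℝ) : ℂ)) k

/-- The Euclidean length `|k|` of a frequency. -/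
noncomputable def freqNorm (k : Fin 2 → ℤ) : ℝ :=
  Real.sqrt ((k 0 : ℝ) ^ 2 + (k 1 : ℝ) ^ 2)

/-- `‖f‖_s = (∑ₖ |k|^{2s} |f̂(k)|²)^{1/2}`, with the value `∞` allowed; for `s > 0` the space `H^s`
consists of the `f` with `‖f‖_s < ∞`. -/
noncomputable def sobolevNorm (s : ℝ) (f : L2) : ℝ≥0∞ :=
  (∑' k : Fin 2 → ℤ, ENNReal.ofReal (freqNorm k ^ (2 * s) * ‖hat f k‖ ^ 2)) ^ (1 / 2 : ℝ)

/-- The Fourier multiplier with symbol `m`: the `L²`-convergent series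
`∑ₖ m(k) f̂(k) exp (i k·x)`. -/
noncomputable def multiplier (m : (Fin 2 → ℤ) → ℂ) (f : L2) :
    Lp ℂ 2 (volume : Measure Torus) :=
  ∑' k : Fin 2 → ℤ, (m k * hat f k) • ContinuousMap.toLp (E := ℂ) 2 volume ℂ (wave k)

/-- The Riesz transform `R_j`, with symbol `-i k_j / |k|` (and `0` at `k = 0`). -/
noncomputable def riesz (j : Fin 2) (f : L2) : Lp ℂ 2 (volume : Measure Torus) :=
  multiplier (fun k => -Complex.I * (k j : ℂ) / (freqNorm k : ℂ)) f

/-- The partial derivative `∂_j`, with symbol `i k_j`. It is used only on functions in `H^s` with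
`s > 1`, for which the series converges in `L²`. -/
noncomputable def partialDeriv (j : Fin 2) (f : L2) : Lp ℂ 2 (volume : Measure Torus) :=
  multiplier (fun k => Complex.I * (k j : ℂ)) f

/-- The velocity `u = (-R₂ θ, R₁ θ)`. -/
noncomputable def velocity (f : L2) : Fin 2 → Lp ℂ 2 (volume : Measure Torus) :=
  ![-(riesz 1 f), riesz 0 f]

/-- The nonlinear term `u · ∇θ`, as a pointwise product of functions. -/
noncomputable def advection (f : L2) (x : Torus) : ℂ :=
  ∑ j, velocity f j x * partialDeriv j f x

/-- `θ` is a solution in `L^∞([0,T]; H^s)` of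
`θ_t + u·∇θ + μ (-Δ)^α θ_t = 0`, `u = (-R₂ θ, R₁ θ)`, `θ(·,0) = θ₀`.
The equation is understood in the sense of periodic distributions in `x` (that is, tested against
all plane waves) and is integrated in time from `0` to every `t ∈ [0,T]`. -/
structure IsSolution (μ α s : ℝ) (θ₀ : L2) (T : ℝ) (θ : ℝ → L2) : Prop where
  measurable : AEStronglyMeasurable θ (volume.restrict (Icc 0 T))
  bounded : ∃ M : ℝ≥0, ∀ᵐ t ∂(volume.restrict (Icc 0 T)), sobolevNorm s (θ t) ≤ M
  initial : θ 0 = θ₀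
  integrable : ∀ k, IntegrableOn (fun τ => coeff (advection (θ τ)) k) (Icc 0 T)
  equation : ∀ t ∈ Icc 0 T, ∀ k,
    ((1 + μ * freqNorm k ^ (2 * α) : ℝ) : ℂ) * (hat (θ t) k - hat θ₀ k) +
      ∫ τ in (0 : ℝ)..t, coeff (advection (θ τ)) k = 0

/-- The supremum `T_* ∈ [0,∞]` of all `T > 0` for which a solution in `L^∞([0,T]; H^s)` exists. -/
noncomputable def maxTime (μ α s : ℝ) (θ₀ : L2) : ℝ≥0∞ :=
  sSup {a | ∃ T : ℝ, 0 < T ∧ (∃ θ, IsSolution μ α s θ₀ T θ) ∧ a = ENNReal.ofReal T}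

end RQG

/-! In the unknowns `a(k) = |k|^s θ̂(k)` the problem is an ordinary differential equation `a' =
F(a)` in `ℓ²`, with `F(a)(k) = -∑ₗ K(k,l) a(l) a(k-l)`. No derivative is lost: the nonlinearity
costs one factor `|k|` (`abs_interaction_le`), and `|k| / (1 + μ|k|^{2α}) ≤ 1/μ` since `α ≥ 1/2`.
The remaining factor `|k|^s |l|^{-s} |k-l|^{-s}` is at most `2^s (|l|^{-s} + |k-l|^{-s})`, and
`|l|^{-s}` is square summable over `ℤ²` because `s > 1`. Cauchy–Schwarz and Young's inequality then
make `F` a bounded quadratic map (`abs_kernel_le`, `tsum_weighted_convolution_sq_le`), hence locally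
Lipschitz. Picard–Lindelöf gives a solution for a time depending only on a bound for the data.

Two points link `ℓ²` to real functions. Hermitian families form a closed subspace invariant under
`F`, so real data give real solutions. The weight `|k|^s` erases the mean, but the mean is conserved
and is restored from the data.

Conversely, let `θ` be any solution in `L^∞(H^s)`. Its `ℓ²` velocity is bounded at almost every
time, so the integrated equation makes `a` Lipschitz on the whole interval
(`IsSolution.exists_sum_le`). Thus `a` is a continuous integral curve of `F`, and uniqueness for the
differential equation applies (`IsSolution.isMildSolution`, `IsSolution.unique`).

By uniqueness all solutions patch into a maximal one. If its norm stayed bounded near a finite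
`T_*`, restarting close to `T_*` would extend it beyond `T_*` (`IsSolution.exists_extension`). -/

namespace RQG

open scoped ComplexConjugate

/-! ### Plane waves as a Hilbert basis of `L²` of the torus. -/

section Wave

variable {m n k : Fin 2 → ℤ} {x : Torus}

lemma wave_apply : wave k x = ∏ j, fourier (k j) (x j) := rfl

lemma wave_neg : wave (-k) x = conj (wave k x) := by
  simp only [wave_apply, Pi.neg_apply, fourier_neg, map_prod]

lemma wave_add : wave (m + n) x = wave m x * wave n x := by
  simp only [wave_apply, Pi.add_apply, fourier_add, ← Finset.prod_mul_distrib]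

lemma wave_zero : wave 0 x = 1 := by simp [wave_apply]

lemma wave_norm : ‖wave k x‖ = 1 := by
  simp only [wave_apply, fourier_apply, norm_prod, Circle.norm_coe, Finset.prod_const_one]

lemma wave_single (i : Fin 2) : wave (Pi.single i 1) x = fourier 1 (x i) := by
  rw [wave_apply, Finset.prod_eq_single i]
  · simp
  · intro j _ hj
    simp [Pi.single_eq_of_ne hj]
  · simp

/-- The star subalgebra generated by the plane waves. -/
noncomputable def waveSubalgebra : StarSubalgebra ℂ C(Torus, ℂ) where
  toSubalgebra := Algebra.adjoin ℂ (range wave)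
  star_mem' := by
    change Algebra.adjoin ℂ (range wave) ≤ star (Algebra.adjoin ℂ (range wave))
    refine Algebra.adjoin_le ?_
    rintro _ ⟨n, rfl⟩
    refine Algebra.subset_adjoin ⟨-n, ?_⟩
    ext1 x
    simp only [wave_neg, starRingEnd_apply, ContinuousMap.star_apply]

lemma waveSubalgebra_coe :
    waveSubalgebra.toSubalgebra.toSubmodule = Submodule.span ℂ (range wave) := by
  apply Algebra.adjoin_eq_span_of_subset
  refine .trans (fun x ↦ Submonoid.closure_induction (fun _ ↦ id) ⟨0, ?_⟩ ?_) Submodule.subset_span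
  · ext z
    simp only [wave_zero, ContinuousMap.one_apply]
  · rintro _ _ _ _ ⟨m, rfl⟩ ⟨n, rfl⟩
    refine ⟨m + n, ?_⟩
    ext z
    simp only [wave_add, ContinuousMap.mul_apply]

lemma waveSubalgebra_separatesPoints : waveSubalgebra.SeparatesPoints := by
  intro x y hxy
  rw [Ne, funext_iff, not_forall] at hxy
  obtain ⟨i, hi⟩ := hxy
  refine ⟨_, ⟨wave (Pi.single i 1), Algebra.subset_adjoin ⟨Pi.single i 1, rfl⟩, rfl⟩, ?_⟩
  dsimp only
  rw [wave_single, wave_single, fourier_one, fourier_one]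
  contrapose hi
  exact AddCircle.injective_toCircle Real.two_pi_pos.ne' (Circle.ext hi)

/-- Stone–Weierstrass: products and conjugates of waves are waves, so their span is a star
subalgebra, and the coordinate waves separate points. -/
lemma span_wave_closure_eq_top :
    (Submodule.span ℂ (range wave)).topologicalClosure = ⊤ := by
  rw [← waveSubalgebra_coe]
  exact congr_arg (Subalgebra.toSubmodule <| StarSubalgebra.toSubalgebra ·)
    (ContinuousMap.starSubalgebra_topologicalClosure_eq_top_of_separatesPoints _
      waveSubalgebra_separatesPoints)

/-- The plane wave as an element of `L²`. -/
noncomputable abbrev waveLp (k : Fin 2 → ℤ) : Lp ℂ 2 (volume : Measure Torus) :=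
  ContinuousMap.toLp (E := ℂ) 2 volume ℂ (wave k)

lemma coeFn_waveLp (k : Fin 2 → ℤ) : waveLp k =ᵐ[volume] wave k :=
  ContinuousMap.coeFn_toLp volume (wave k)

lemma span_waveLp_closure_eq_top :
    (Submodule.span ℂ (range waveLp)).topologicalClosure = ⊤ := by
  simpa only [Submodule.map_span, ContinuousLinearMap.coe_coe, ← range_comp,
    Function.comp_def] using
    (ContinuousMap.toLp_denseRange ℂ (volume : Measure Torus) ℂ
      (p := 2) (by simp)).topologicalClosure_map_submodule span_wave_closure_eq_top

lemma integral_fourier (n : ℤ) :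
    ∫ x : AddCircle (2 * π), fourier n x = if n = 0 then (2 * π : ℂ) else 0 := by
  have h := (orthonormal_iff_ite.mp (orthonormal_fourier (T := 2 * π))) 0 n
  simp only [ContinuousMap.inner_toLp, ← fourier_neg, ← fourier_add] at h
  rw [AddCircle.volume_eq_smul_haarAddCircle, integral_smul_measure,
    ENNReal.toReal_ofReal Real.two_pi_pos.le]
  simp only [neg_zero, add_zero] at h
  rw [h]
  simp only [eq_comm (a := (0 : ℤ))]
  split_ifs <;> simp

lemma integral_wave (k : Fin 2 → ℤ) :
    ∫ x, wave k x = if k = 0 then (2 * π : ℂ) ^ 2 else 0 := by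
  simp only [wave_apply]
  rw [MeasureTheory.integral_fintype_prod_volume_eq_prod (fun j x => fourier (k j) x)]
  simp only [integral_fourier]
  split_ifs with h
  · simp [h]
  · obtain ⟨i, hi⟩ := Function.ne_iff.mp h
    exact Finset.prod_eq_zero (Finset.mem_univ i) (by simpa using hi)

lemma inner_waveLp (m n : Fin 2 → ℤ) :
    inner ℂ (waveLp m) (waveLp n) = if m = n then (2 * π : ℂ) ^ 2 else 0 := by
  simp only [ContinuousMap.inner_toLp, ← wave_neg, ← wave_add, integral_wave]
  congr 1
  rw [eq_iff_iff]
  constructor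
  · intro h
    have := eq_neg_of_add_eq_zero_left h
    simpa using this.symm
  · rintro rfl
    simp

lemma orthonormal_wave :
    Orthonormal ℂ (fun k => ((2 * π : ℂ)⁻¹) • waveLp k) := by
  rw [orthonormal_iff_ite]
  intro m n
  rw [inner_smul_left, inner_smul_right, inner_waveLp]
  have : (π : ℂ) ≠ 0 := by exact_mod_cast Real.pi_ne_zero
  split_ifs
  · simp only [map_inv₀, map_mul, Complex.conj_ofReal, Complex.conj_ofNat]
    field_simp
  · simp

/-- The normalised plane waves form a Hilbert basis of `L²`. -/
noncomputable def waveBasis : HilbertBasis (Fin 2 → ℤ) ℂ (Lp ℂ 2 (volume : Measure Torus)) :=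
  HilbertBasis.mk orthonormal_wave (by
    have h2 : (2 * π : ℂ)⁻¹ ≠ 0 := by
      have : (π : ℂ) ≠ 0 := by exact_mod_cast Real.pi_ne_zero
      simp [this]
    have : Submodule.span ℂ (range waveLp) ≤
        Submodule.span ℂ (range fun k => ((2 * π : ℂ)⁻¹) • waveLp k) := by
      rw [Submodule.span_le]
      rintro _ ⟨k, rfl⟩
      have := Submodule.smul_mem _ ((2 * π : ℂ)⁻¹)⁻¹ (Submodule.subset_span (R := ℂ)
        (mem_range_self (f := fun k => ((2 * π : ℂ)⁻¹) • waveLp k) k))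
      simpa only [smul_smul, inv_mul_cancel₀ h2, one_smul, SetLike.mem_coe] using this
    rw [← span_waveLp_closure_eq_top]
    exact Submodule.topologicalClosure_mono this)

lemma waveBasis_apply (k : Fin 2 → ℤ) : waveBasis k = ((2 * π : ℂ)⁻¹) • waveLp k := by
  rw [waveBasis, HilbertBasis.coe_mk]

end Wave

/-! ### Fourier coefficients as coordinates in the wave basis. -/

section Coeff

variable {k : Fin 2 → ℤ}

lemma two_pi_ne_zero : (2 * π : ℂ) ≠ 0 := by
  have : (π : ℂ) ≠ 0 := by exact_mod_cast Real.pi_ne_zero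
  simp [this]

lemma coeff_congr {f g : Torus → ℂ} (h : f =ᵐ[volume] g) : coeff f k = coeff g k := by
  unfold coeff
  congr 1
  apply integral_congr_ae
  filter_upwards [h] with x hx
  rw [hx]

lemma inner_waveLp_left (k : Fin 2 → ℤ) (g : Lp ℂ 2 (volume : Measure Torus)) :
    inner ℂ (waveLp k) g = (2 * π : ℂ) ^ 2 * coeff g k := by
  have h := two_pi_ne_zero
  rw [coeff, ← mul_assoc, mul_one_div_cancel (pow_ne_zero 2 h), one_mul, L2.inner_def]
  apply integral_congr_ae
  filter_upwards [coeFn_waveLp k] with x hx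
  rw [hx, wave_neg, RCLike.inner_apply]

lemma waveBasis_repr (g : Lp ℂ 2 (volume : Measure Torus)) (k : Fin 2 → ℤ) :
    waveBasis.repr g k = (2 * π : ℂ) * coeff g k := by
  have h := two_pi_ne_zero
  rw [waveBasis.repr_apply_apply, waveBasis_apply, inner_smul_left, inner_waveLp_left]
  simp only [map_inv₀, map_mul, Complex.conj_ofReal, Complex.conj_ofNat]
  field_simp

lemma coeff_eq_repr (g : Lp ℂ 2 (volume : Measure Torus)) (k : Fin 2 → ℤ) :
    coeff g k = (2 * π : ℂ)⁻¹ * waveBasis.repr g k := by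
  rw [waveBasis_repr, inv_mul_cancel_left₀ two_pi_ne_zero]

lemma summable_coeff_sq (g : Lp ℂ 2 (volume : Measure Torus)) :
    Summable fun k => ‖coeff g k‖ ^ 2 := by
  have := (memℓp_gen_iff (p := 2) (by simp)).1 (lp.memℓp (waveBasis.repr g))
  simp only [ENNReal.toReal_ofNat, Real.rpow_ofNat] at this
  refine (this.mul_left (‖(2 * π : ℂ)⁻¹‖ ^ 2)).congr fun k => ?_
  rw [coeff_eq_repr, norm_mul, mul_pow]

/-- The complexification of a real-valued `L²` function. -/
noncomputable def toComplex : L2 →L[ℝ] Lp ℂ 2 (volume : Measure Torus) :=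
  Complex.ofRealCLM.compLpL 2 volume

lemma coeFn_toComplex (f : L2) : toComplex f =ᵐ[volume] fun x => ((f x : ℝ) : ℂ) :=
  Complex.ofRealCLM.coeFn_compLp f

lemma hat_eq_coeff (f : L2) : hat f k = coeff (toComplex f) k :=
  (coeff_congr (coeFn_toComplex f)).symm

lemma hat_add (f g : L2) : hat (f + g) k = hat f k + hat g k := by
  simp only [hat_eq_coeff, coeff_eq_repr, map_add, lp.coeFn_add, Pi.add_apply, mul_add]

lemma summable_hat_sq (f : L2) : Summable fun k => ‖hat f k‖ ^ 2 := by
  simpa only [hat_eq_coeff] using summable_coeff_sq (toComplex f)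

lemma hat_neg_freq (f : L2) (k : Fin 2 → ℤ) : hat f (-k) = conj (hat f k) := by
  simp only [hat, coeff, map_mul, ← integral_conj]
  have h2 : conj (2 * π : ℂ) = 2 * π := by
    rw [map_mul, Complex.conj_ofReal, Complex.conj_ofNat]
  simp only [map_div₀, map_one, map_pow, h2, Complex.conj_ofReal, wave_neg, Complex.conj_conj]

lemma hat_injective {f g : L2} (h : ∀ k, hat f k = hat g k) : f = g := by
  have h1 : toComplex f = toComplex g := by
    apply waveBasis.repr.injective
    ext k
    rw [waveBasis_repr, waveBasis_repr, ← hat_eq_coeff, ← hat_eq_coeff, h]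
  ext1
  filter_upwards [coeFn_toComplex f, coeFn_toComplex g] with x hf hg
  rw [h1, hg] at hf
  exact_mod_cast hf.symm

end Coeff

/-! ### Fourier multipliers. -/

section Multiplier

variable {m : (Fin 2 → ℤ) → ℂ} {f : L2}

/-- Square summable coefficients are the coordinates of an `L²` function, so the `tsum` in
`multiplier` is a genuine sum. -/
lemma hasSum_multiplier (h : Summable fun k => ‖m k * hat f k‖ ^ 2) :
    HasSum (fun k => (m k * hat f k) • waveLp k) (multiplier m f) := by
  have hmem : Memℓp (fun k => (2 * π : ℂ) * (m k * hat f k)) 2 := by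
    rw [memℓp_gen_iff (by simp)]
    simp only [ENNReal.toReal_ofNat, Real.rpow_ofNat]
    refine (h.mul_left (‖(2 * π : ℂ)‖ ^ 2)).congr fun k => ?_
    rw [norm_mul _ (m k * hat f k), mul_pow]
  have := waveBasis.hasSum_repr_symm ⟨_, hmem⟩
  have h2 : Summable (fun k => (m k * hat f k) • waveLp k) := by
    refine this.summable.congr fun k => ?_
    rw [waveBasis_apply, smul_smul]
    congr 1
    rw [mul_comm, inv_mul_cancel_left₀ two_pi_ne_zero]
  exact h2.hasSum

lemma coeff_multiplier (h : Summable fun k => ‖m k * hat f k‖ ^ 2) (k : Fin 2 → ℤ) :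
    coeff (multiplier m f) k = m k * hat f k := by
  have h1 := (hasSum_multiplier h).mapL (innerSL ℂ (waveLp k))
  simp only [innerSL_apply_apply, inner_smul_right, inner_waveLp] at h1
  have h2 : HasSum (fun j => m j * hat f j * if k = j then (2 * π : ℂ) ^ 2 else 0)
      (m k * hat f k * (2 * π : ℂ) ^ 2) := by
    convert hasSum_single k ?_ using 1
    · simp
    · intro j hj
      simp [hj.symm]
  have h3 := h1.unique h2
  rw [inner_waveLp_left, mul_comm] at h3
  exact mul_right_cancel₀ (pow_ne_zero 2 two_pi_ne_zero) h3

end Multiplier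

/-! ### Fourier coefficients of products and of `u · ∇θ`. -/

section Product

lemma freqNorm_nonneg (k : Fin 2 → ℤ) : 0 ≤ freqNorm k := Real.sqrt_nonneg _

lemma freqNorm_sq (k : Fin 2 → ℤ) : freqNorm k ^ 2 = (k 0 : ℝ) ^ 2 + (k 1 : ℝ) ^ 2 :=
  Real.sq_sqrt (by positivity)

lemma freqNorm_zero : freqNorm 0 = 0 := by simp [freqNorm]

lemma freqNorm_neg (k : Fin 2 → ℤ) : freqNorm (-k) = freqNorm k := by simp [freqNorm]

lemma one_le_freqNorm {k : Fin 2 → ℤ} (hk : k ≠ 0) : 1 ≤ freqNorm k := by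
  rw [freqNorm, Real.one_le_sqrt]
  by_contra! h
  have h' : k 0 ^ 2 + k 1 ^ 2 < 1 := by exact_mod_cast h
  apply hk
  ext i
  fin_cases i <;> simp <;> nlinarith [sq_nonneg (k 0), sq_nonneg (k 1)]

lemma abs_apply_le_freqNorm (k : Fin 2 → ℤ) (j : Fin 2) : |(k j : ℝ)| ≤ freqNorm k := by
  apply Real.abs_le_sqrt
  fin_cases j <;> simp <;> positivity

/-- The product of two `L²` functions need not be in `L²`, but for fixed `h` its `k`-th coefficient
is, up to a constant, the inner product of `g` with the `L²` function `conj (h · wave (-k))`. It is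
therefore continuous in `g` and may be taken term by term. -/
lemma hasSum_coeff_mul {c : (Fin 2 → ℤ) → ℂ} {g : Lp ℂ 2 (volume : Measure Torus)}
    (hg : HasSum (fun l => c l • waveLp l) g) (h : Lp ℂ 2 (volume : Measure Torus))
    (k : Fin 2 → ℤ) :
    HasSum (fun l => c l * coeff h (k - l)) (coeff (fun x => g x * h x) k) := by
  have hmem : MemLp (fun x => conj (h x * wave (-k) x)) 2 (volume : Measure Torus) := by
    refine (Lp.memLp h).of_le ?_ (ae_of_all _ fun x => ?_)
    · exact Complex.continuous_conj.comp_aestronglyMeasurable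
        ((Lp.aestronglyMeasurable h).mul (wave (-k)).continuous.aestronglyMeasurable)
    · rw [RCLike.norm_conj, norm_mul, wave_norm, mul_one]
  have key : ∀ g' : Lp ℂ 2 (volume : Measure Torus),
      inner ℂ (hmem.toLp) g' = (2 * π : ℂ) ^ 2 * coeff (fun x => g' x * h x) k := by
    intro g'
    rw [coeff, ← mul_assoc, mul_one_div_cancel (pow_ne_zero 2 two_pi_ne_zero), one_mul,
      L2.inner_def]
    apply integral_congr_ae
    filter_upwards [hmem.coeFn_toLp] with x hx
    rw [hx, RCLike.inner_apply, Complex.conj_conj, mul_assoc]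
  have hwave : ∀ l, coeff (fun x => waveLp l x * h x) k = coeff h (k - l) := by
    intro l
    unfold coeff
    congr 1
    apply integral_congr_ae
    filter_upwards [coeFn_waveLp l] with x hx
    rw [hx, neg_sub, sub_eq_add_neg, wave_add]
    ring
  have hterm : ∀ l, inner ℂ (hmem.toLp) (c l • waveLp l) =
      c l * ((2 * π : ℂ) ^ 2 * coeff h (k - l)) := by
    intro l
    rw [inner_smul_right, key, hwave]
  have h1 := hg.mapL (innerSL ℂ hmem.toLp)
  simp only [innerSL_apply_apply, hterm] at h1
  rw [key] at h1
  have h2 := h1.mul_left (((2 * π : ℂ) ^ 2)⁻¹)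
  rw [inv_mul_cancel_left₀ (pow_ne_zero 2 two_pi_ne_zero)] at h2
  refine h2.congr_fun fun l => ?_
  rw [mul_left_comm, inv_mul_cancel_left₀ (pow_ne_zero 2 two_pi_ne_zero)]

lemma coeff_sum_mul (g h : Fin 2 → Lp ℂ 2 (volume : Measure Torus)) (k : Fin 2 → ℤ) :
    coeff (fun x => ∑ j, g j x * h j x) k = ∑ j, coeff (fun x => g j x * h j x) k := by
  have hi : ∀ j, Integrable (fun x => g j x * h j x * wave (-k) x) (volume : Measure Torus) := by
    intro j
    have h1 : Integrable (fun x => g j x * h j x) (volume : Measure Torus) :=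
      (Lp.memLp (g j)).integrable_mul (Lp.memLp (h j))
    refine h1.mono (h1.1.mul (wave (-k)).continuous.aestronglyMeasurable)
      (ae_of_all _ fun x => ?_)
    rw [norm_mul _ (wave (-k) x), wave_norm, mul_one]
  simp only [coeff, Finset.sum_mul, ← Finset.mul_sum]
  rw [integral_finsetSum _ fun j _ => hi j]

/-- The coefficient with which the product `θ̂(l) θ̂(k - l)` enters the `k`-th Fourier coefficient
of `u · ∇θ`. -/
noncomputable def interaction (k l : Fin 2 → ℤ) : ℝ :=
  ((l 0 : ℝ) * k 1 - (l 1 : ℝ) * k 0) / freqNorm l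

/-- The symbols of `u` and `∇` combine to the cross product of `l` with `k - l`, which equals that
of `l` with `k`; the derivative thus falls on the output frequency `k`. -/
lemma hasSum_coeff_advection {f : L2} (hf : Summable fun k => (freqNorm k * ‖hat f k‖) ^ 2)
    (k : Fin 2 → ℤ) :
    HasSum (fun l => (interaction k l : ℂ) * hat f l * hat f (k - l)) (coeff (advection f) k) := by
  have hR : ∀ j, Summable fun l => ‖-Complex.I * (l j : ℂ) / (freqNorm l : ℂ) * hat f l‖ ^ 2 := by
    intro j
    refine Summable.of_nonneg_of_le (fun _ => by positivity) (fun l => ?_) (summable_hat_sq f)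
    rw [norm_mul, mul_pow]
    refine mul_le_of_le_one_left (by positivity) ?_
    rw [norm_div, norm_mul, norm_neg, Complex.norm_I, one_mul, Complex.norm_real, Real.norm_eq_abs,
      abs_of_nonneg (freqNorm_nonneg l)]
    refine pow_le_one₀ (div_nonneg (norm_nonneg _) (freqNorm_nonneg l))
      (div_le_one_of_le₀ ?_ (freqNorm_nonneg l))
    rw [Complex.norm_intCast]
    exact abs_apply_le_freqNorm l j
  have hD : ∀ j : Fin 2, Summable fun l => ‖Complex.I * (l j : ℂ) * hat f l‖ ^ 2 := by
    intro j
    refine Summable.of_nonneg_of_le (fun _ => by positivity) (fun l => ?_) hf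
    rw [norm_mul, norm_mul, Complex.norm_I, one_mul, Complex.norm_intCast]
    gcongr
    exact abs_apply_le_freqNorm l j
  have hV0 : HasSum (fun l => (Complex.I * (l 1 : ℂ) / (freqNorm l : ℂ) * hat f l) • waveLp l)
      (velocity f 0) := by
    convert! (hasSum_multiplier (hR 1)).neg using 2 with l
    rw [← neg_smul]
    congr 1
    ring
  have hV1 : HasSum (fun l => (-Complex.I * (l 0 : ℂ) / (freqNorm l : ℂ) * hat f l) • waveLp l)
      (velocity f 1) := hasSum_multiplier (hR 0)
  have h0 := hasSum_coeff_mul hV0 (partialDeriv 0 f) k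
  have h1 := hasSum_coeff_mul hV1 (partialDeriv 1 f) k
  have hadv : coeff (advection f) k = _ := coeff_sum_mul (velocity f) (fun j => partialDeriv j f) k
  rw [hadv, Fin.sum_univ_two]
  convert! h0.add h1 using 2 with l
  simp only [partialDeriv, coeff_multiplier (hD _), interaction, Pi.sub_apply]
  push_cast
  linear_combination (-((l 1 : ℂ) * ((k 0 : ℂ) - l 0) - (l 0 : ℂ) * ((k 1 : ℂ) - l 1)) /
    (freqNorm l : ℂ) * hat f l * hat f (k - l)) * Complex.I_sq

end Product

/-! ### Quadratic maps are locally Lipschitz. -/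

section QuadraticLipschitz

variable {E : Type*} [NormedAddCommGroup E] {F : E → E} {C : ℝ≥0}

/-- The local Lipschitz bound satisfied by a bounded homogeneous quadratic map. -/
def QuadraticLipschitz (F : E → E) (C : ℝ≥0) : Prop :=
  ∀ x y, ‖F x - F y‖ ≤ C * (‖x‖ + ‖y‖) * ‖x - y‖

lemma QuadraticLipschitz.lipschitzOnWith (hF : QuadraticLipschitz F C) (R : ℝ≥0) :
    LipschitzOnWith (C * (2 * R)) F (Metric.closedBall 0 R) := by
  refine LipschitzOnWith.of_dist_le_mul fun x hx y hy => ?_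
  rw [dist_eq_norm, dist_eq_norm]
  refine (hF x y).trans ?_
  rw [mem_closedBall_zero_iff] at hx hy
  push_cast
  gcongr
  linarith

lemma QuadraticLipschitz.norm_le (hF : QuadraticLipschitz F C) (h0 : F 0 = 0) (x : E) :
    ‖F x‖ ≤ C * ‖x‖ ^ 2 := by
  have := hF x 0
  simp only [h0, sub_zero, norm_zero, add_zero] at this
  linarith [this, mul_assoc (C : ℝ) ‖x‖ ‖x‖, sq ‖x‖]

lemma QuadraticLipschitz.continuous (hF : QuadraticLipschitz F C) : Continuous F := by
  rw [continuous_iff_continuousAt]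
  intro x
  have hx : Metric.closedBall (0 : E) (‖x‖₊ + 1 : ℝ≥0) ∈ 𝓝 x := by
    apply Metric.closedBall_mem_nhds_of_mem
    simp
  exact ((hF.lipschitzOnWith (‖x‖₊ + 1)).continuousOn).continuousAt hx

end QuadraticLipschitz

/-! ### Ordinary differential equations with a quadratic right-hand side. -/

section MildSolution

variable {E : Type*} [NormedAddCommGroup E] [NormedSpace ℝ E]

/-- A continuous curve solving the integral form of `c' = F c`, `c 0 = x₀` on `[0, T]`. -/
structure IsMildSolution (F : E → E) (x₀ : E) (T : ℝ) (c : ℝ → E) : Prop where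
  continuousOn : ContinuousOn c (Icc 0 T)
  eq : ∀ t ∈ Icc 0 T, c t = x₀ + ∫ τ in (0 : ℝ)..t, F (c τ)

variable {F : E → E} {x₀ : E} {T : ℝ} {c d : ℝ → E} {C : ℝ≥0}

/-- A lower bound for the existence time of `c' = F c` with data of norm at most `b`. -/
noncomputable def existenceTime (C b : ℝ≥0) : ℝ := (b + 1) / (C * (2 * b + 1) ^ 2 + 1)

lemma existenceTime_pos (C b : ℝ≥0) : 0 < existenceTime C b := by
  unfold existenceTime
  positivity

lemma IsMildSolution.initial (hc : IsMildSolution F x₀ T c) (hT : 0 ≤ T) : c 0 = x₀ := by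
  simpa using hc.eq 0 ⟨le_rfl, hT⟩

lemma IsMildSolution.congr (hc : IsMildSolution F x₀ T c) (h : ∀ t ∈ Icc 0 T, d t = c t) :
    IsMildSolution F x₀ T d where
  continuousOn := hc.continuousOn.congr h
  eq t ht := by
    rw [h t ht, hc.eq t ht]
    congr 1
    refine intervalIntegral.integral_congr fun τ hτ => ?_
    rw [uIcc_of_le ht.1] at hτ
    simp only [h τ ⟨hτ.1, hτ.2.trans ht.2⟩]

lemma IsMildSolution.mono (hc : IsMildSolution F x₀ T c) {T' : ℝ} (h : T' ≤ T) :
    IsMildSolution F x₀ T' c where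
  continuousOn := hc.continuousOn.mono (Icc_subset_Icc_right h)
  eq t ht := hc.eq t ⟨ht.1, ht.2.trans h⟩

lemma IsMildSolution.glue {t₀ τ₀ : ℝ} (h₀ : 0 ≤ t₀) (hτ : 0 ≤ τ₀) (hF : Continuous F)
    (hc : IsMildSolution F x₀ t₀ c) (hd : IsMildSolution F (c t₀) τ₀ d) :
    ∃ e, IsMildSolution F x₀ (t₀ + τ₀) e ∧ (∀ t ≤ t₀, e t = c t) ∧
      ∀ t, t₀ ≤ t → e t = d (t - t₀) := by
  have hd0 := hd.initial hτ
  -- With one formula for both pieces, continuity needs no case distinction.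
  set e : ℝ → E := fun t => c (min t t₀) + (d (max (t - t₀) 0) - c t₀) with he
  have he1 : ∀ t ≤ t₀, e t = c t := fun t ht => by
    simp [he, min_eq_left ht, max_eq_right (sub_nonpos.2 ht), hd0]
  have he2 : ∀ t, t₀ ≤ t → e t = d (t - t₀) := fun t ht => by
    simp [he, min_eq_right ht, max_eq_left (sub_nonneg.2 ht)]
  have hcont : ContinuousOn e (Icc 0 (t₀ + τ₀)) := by
    refine (hc.continuousOn.comp (by fun_prop) fun t ht => ?_).add
      ((hd.continuousOn.comp (by fun_prop) fun t ht => ?_).sub continuousOn_const)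
    · exact ⟨le_min ht.1 h₀, min_le_right _ _⟩
    · exact ⟨le_max_right _ _, max_le (by linarith [ht.2]) hτ⟩
  refine ⟨e, ⟨hcont, fun t ht => ?_⟩, he1, he2⟩
  have hint : ∀ a b, 0 ≤ a → a ≤ b → b ≤ t₀ + τ₀ →
      IntervalIntegrable (fun τ => F (e τ)) volume a b := fun a b h1 h2 h3 =>
    ((hF.comp_continuousOn hcont).mono (Icc_subset_Icc h1 h3)).intervalIntegrable_of_Icc h2
  rcases le_total t t₀ with h | h
  · rw [he1 t h, hc.eq t ⟨ht.1, h⟩]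
    congr 1
    refine intervalIntegral.integral_congr fun τ hτ => ?_
    rw [uIcc_of_le ht.1] at hτ
    simp only [he1 τ (hτ.2.trans h)]
  · rw [he2 t h, hd.eq (t - t₀) ⟨by linarith, by linarith [ht.2]⟩, hc.eq t₀ ⟨h₀, le_rfl⟩,
      ← intervalIntegral.integral_add_adjacent_intervals (hint 0 t₀ le_rfl h₀ (by linarith))
        (hint t₀ t h₀ h ht.2), add_assoc]
    congr 2
    · refine intervalIntegral.integral_congr fun τ hτ => ?_
      rw [uIcc_of_le h₀] at hτ
      simp only [he1 τ hτ.2]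
    · rw [← sub_self t₀, ← intervalIntegral.integral_comp_sub_right (fun τ => F (d τ))]
      refine intervalIntegral.integral_congr fun τ hτ => ?_
      rw [uIcc_of_le h] at hτ
      simp only [he2 τ hτ.1]

variable [CompleteSpace E]

lemma exists_isMildSolution (hF : QuadraticLipschitz F C) (h0 : F 0 = 0) (b : ℝ≥0) (hx : ‖x₀‖ ≤ b) :
    ∃ c, IsMildSolution F x₀ (existenceTime C b) c := by
  have hT := existenceTime_pos C b
  have hball : Metric.closedBall x₀ (b + 1 : ℝ≥0) ⊆ Metric.closedBall 0 (2 * b + 1 : ℝ≥0) := by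
    apply Metric.closedBall_subset_closedBall'
    rw [dist_zero_right]
    push_cast
    linarith
  -- The ball of radius `b + 1` about `x₀` lies in that of radius `2b + 1` about `0`, where `‖F‖ ≤ C
  -- (2b + 1)²`. A curve at that speed stays inside up to time `existenceTime C b`, whose extra `+
  -- 1` in the denominator covers `C = 0`.
  have hPL : IsPicardLindelof (fun _ => F)
      (⟨0, le_rfl, hT.le⟩ : Icc (0 : ℝ) (existenceTime C b)) x₀ (b + 1) 0
      (C * (2 * b + 1) ^ 2) (C * (2 * (2 * b + 1))) :=
    { lipschitzOnWith := fun t _ => (hF.lipschitzOnWith (2 * b + 1)).mono hball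
      continuousOn := fun x _ => continuousOn_const
      norm_le := fun t _ x hx' => by
        have := hball hx'
        rw [mem_closedBall_zero_iff] at this
        refine (hF.norm_le h0 x).trans ?_
        push_cast at this ⊢
        gcongr
      mul_max_le := by
        simp only [sub_zero, sub_self, NNReal.coe_zero]
        rw [max_eq_left hT.le, existenceTime]
        push_cast
        rw [mul_div_assoc', div_le_iff₀ (by positivity)]
        nlinarith [b.coe_nonneg, C.coe_nonneg] }
  obtain ⟨c, hc0, hc⟩ := hPL.exists_eq_forall_mem_Icc_hasDerivWithinAt₀
  have hcont : ContinuousOn c (Icc 0 (existenceTime C b)) :=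
    fun t ht => (hc t ht).continuousWithinAt
  refine ⟨c, hcont, fun t ht => ?_⟩
  have hsub : Icc 0 t ⊆ Icc 0 (existenceTime C b) := Icc_subset_Icc_right ht.2
  rw [intervalIntegral.integral_eq_sub_of_hasDerivAt_of_le ht.1 (hcont.mono hsub)
    (fun τ hτ => (hc τ (hsub (Ioo_subset_Icc_self hτ))).hasDerivAt
      (Icc_mem_nhds hτ.1 (hτ.2.trans_le ht.2)))
    (((hF.continuous.comp_continuousOn hcont).mono hsub).intervalIntegrable_of_Icc ht.1)]
  simp only at hc0
  rw [hc0]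
  abel

/-- Solutions starting in a closed invariant subspace can be found in that subspace. -/
lemma exists_isMildSolution_mem (hF : QuadraticLipschitz F C) (h0 : F 0 = 0) (p : Submodule ℝ E)
    (hp : IsClosed (p : Set E)) (hinv : ∀ x ∈ p, F x ∈ p) (hx₀ : x₀ ∈ p) {b : ℝ≥0}
    (hb : ‖x₀‖ ≤ b) :
    ∃ c, IsMildSolution F x₀ (existenceTime C b) c ∧ ∀ t, c t ∈ p := by
  have : CompleteSpace p := hp.completeSpace_coe
  -- The equation is solved inside the complete space `p`; the inclusion commutes with the integral.
  let G : p → p := fun a => ⟨F a, hinv a a.2⟩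
  have hG : QuadraticLipschitz G C := fun a b => hF a b
  obtain ⟨c, hc⟩ := exists_isMildSolution (x₀ := ⟨x₀, hx₀⟩) hG (Subtype.ext h0) b hb
  refine ⟨fun t => c t, ⟨p.subtypeL.continuous.comp_continuousOn hc.continuousOn,
    fun t ht => ?_⟩, fun t => (c t).2⟩
  have hint : IntervalIntegrable (fun τ => G (c τ)) volume 0 t :=
    ((hG.continuous.comp_continuousOn hc.continuousOn).mono
      (Icc_subset_Icc_right ht.2)).intervalIntegrable_of_Icc ht.1
  have h1 : ∫ τ in (0 : ℝ)..t, F (c τ) = p.subtypeL (∫ τ in (0 : ℝ)..t, G (c τ)) :=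
    p.subtypeL.intervalIntegral_comp_comm hint
  rw [h1, hc.eq t ht]
  rfl

lemma IsMildSolution.hasDerivWithinAt (hF : Continuous F) (hc : IsMildSolution F x₀ T c)
    {t : ℝ} (ht : t ∈ Ico 0 T) : HasDerivWithinAt c (F (c t)) (Ici t) t := by
  have hT : 0 ≤ T := ht.1.trans ht.2.le
  -- Freezing the integrand outside `[0, T]` makes it continuous on all of `ℝ`, as the fundamental
  -- theorem of calculus wants.
  set g : ℝ → E := fun τ => F (c (projIcc 0 T hT τ)) with hg
  have hgc : Continuous g := by
    refine hF.comp ?_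
    exact (continuousOn_iff_continuous_domRestrict.1 hc.continuousOn).comp continuous_projIcc
  have hge : ∀ τ ∈ Icc 0 T, g τ = F (c τ) := fun τ hτ => by
    simp [hg, projIcc_of_mem hT hτ]
  have h1 : HasDerivWithinAt (fun t => x₀ + ∫ τ in (0 : ℝ)..t, g τ) (g t) (Icc 0 T) t :=
    ((hgc.integral_hasStrictDerivAt 0 t).hasDerivAt.const_add x₀).hasDerivWithinAt
  rw [hge t (Ico_subset_Icc_self ht)] at h1
  have h2 : HasDerivWithinAt c (F (c t)) (Icc 0 T) t := by
    refine h1.congr_of_mem (fun r hr => ?_) (Ico_subset_Icc_self ht)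
    rw [hc.eq r hr]
    congr 1
    refine intervalIntegral.integral_congr fun τ hτ => ?_
    rw [uIcc_of_le hr.1] at hτ
    exact (hge τ ⟨hτ.1, hτ.2.trans hr.2⟩).symm
  refine h2.mono_of_mem_nhdsWithin ?_
  exact mem_of_superset (Icc_mem_nhdsGE ht.2) (Icc_subset_Icc_left ht.1)

/-- Both curves are bounded on the compact interval, hence stay in one ball, on which `F` is
Lipschitz. -/
lemma IsMildSolution.unique (hF : QuadraticLipschitz F C) (hc : IsMildSolution F x₀ T c)
    (hd : IsMildSolution F x₀ T d) : ∀ t ∈ Icc 0 T, c t = d t := by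
  intro t ht
  have hT : 0 ≤ T := ht.1.trans ht.2
  obtain ⟨R₁, h₁⟩ := isCompact_Icc.exists_bound_of_continuousOn hc.continuousOn
  obtain ⟨R₂, h₂⟩ := isCompact_Icc.exists_bound_of_continuousOn hd.continuousOn
  set R : ℝ≥0 := Real.toNNReal (max R₁ R₂)
  have hR : max R₁ R₂ ≤ R := Real.le_coe_toNNReal _
  refine ODE_solution_unique_of_mem_Icc_right (v := fun _ => F)
    (s := fun _ => Metric.closedBall 0 R) (fun t _ => hF.lipschitzOnWith R)
    hc.continuousOn (fun t ht => hc.hasDerivWithinAt hF.continuous ht) (fun t ht => ?_)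
    hd.continuousOn (fun t ht => hd.hasDerivWithinAt hF.continuous ht) (fun t ht => ?_)
    ((hc.initial hT).trans (hd.initial hT).symm) ht
  · rw [mem_closedBall_zero_iff]
    exact (h₁ t (Ico_subset_Icc_self ht)).trans ((le_max_left _ _).trans hR)
  · rw [mem_closedBall_zero_iff]
    exact (h₂ t (Ico_subset_Icc_self ht)).trans ((le_max_right _ _).trans hR)

end MildSolution

/-! ### Convolution inequalities in `[0, ∞]`. -/

section Convolution

lemma ennreal_mul_le_sq_add_sq (a b : ℝ≥0∞) : a * b ≤ a ^ 2 + b ^ 2 := by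
  rcases le_total a b with h | h
  · calc a * b ≤ b * b := by gcongr
      _ ≤ a ^ 2 + b ^ 2 := by rw [← sq]; exact le_add_self
  · calc a * b ≤ a * a := by gcongr
      _ ≤ a ^ 2 + b ^ 2 := by rw [← sq]; exact le_self_add

lemma ennreal_add_sq_le (a b : ℝ≥0∞) : (a + b) ^ 2 ≤ 3 * (a ^ 2 + b ^ 2) := by
  calc (a + b) ^ 2 = a ^ 2 + b ^ 2 + 2 * (a * b) := by ring
    _ ≤ a ^ 2 + b ^ 2 + 2 * (a ^ 2 + b ^ 2) := by gcongr; exact ennreal_mul_le_sq_add_sq a b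
    _ = 3 * (a ^ 2 + b ^ 2) := by ring

lemma ennreal_tsum_mul_sq_le {I : Type*} (x y : I → ℝ≥0∞) :
    (∑' i, x i * y i) ^ 2 ≤ (∑' i, x i ^ 2) * ∑' i, y i ^ 2 := by
  have h : ∑' i, x i * y i ≤
      (∑' i, x i ^ 2) ^ (1 / 2 : ℝ) * (∑' i, y i ^ 2) ^ (1 / 2 : ℝ) := by
    rw [ENNReal.tsum_eq_iSup_sum]
    refine iSup_le fun S => (ENNReal.inner_le_Lp_mul_Lq S x y Real.HolderConjugate.two_two).trans ?_
    simp only [ENNReal.rpow_ofNat]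
    gcongr <;> exact ENNReal.sum_le_tsum S
  calc (∑' i, x i * y i) ^ 2
      ≤ ((∑' i, x i ^ 2) ^ (1 / 2 : ℝ) * (∑' i, y i ^ 2) ^ (1 / 2 : ℝ)) ^ 2 := by gcongr
    _ = (∑' i, x i ^ 2) * ∑' i, y i ^ 2 := by
      rw [mul_pow, ← ENNReal.rpow_natCast, ← ENNReal.rpow_natCast, ← ENNReal.rpow_mul,
        ← ENNReal.rpow_mul]
      norm_num

variable {I : Type*} [AddCommGroup I]

/-- Young's inequality `ℓ¹ * ℓ² ⊆ ℓ²`, up to a constant. -/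
lemma tsum_convolution_sq_le (x y : I → ℝ≥0∞) :
    ∑' k, (∑' l, x l * y (k - l)) ^ 2 ≤ 2 * (∑' l, x l) ^ 2 * ∑' k, y k ^ 2 := by
  have hshift : ∀ l, ∑' k, y (k - l) ^ 2 = ∑' k, y k ^ 2 := fun l =>
    (Equiv.subRight l).tsum_eq fun k => y k ^ 2
  -- Expanding the square leaves the autocorrelations of `y`, bounded uniformly in the shifts; the
  -- crude `ab ≤ a² + b²` costs the factor `2`.
  have hcorr : ∀ l m, ∑' k, y (k - l) * y (k - m) ≤ 2 * ∑' k, y k ^ 2 := fun l m => by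
    calc ∑' k, y (k - l) * y (k - m)
        ≤ ∑' k, (y (k - l) ^ 2 + y (k - m) ^ 2) :=
          ENNReal.tsum_le_tsum fun k => ennreal_mul_le_sq_add_sq _ _
      _ = 2 * ∑' k, y k ^ 2 := by rw [ENNReal.tsum_add, hshift, hshift, two_mul]
  calc ∑' k, (∑' l, x l * y (k - l)) ^ 2
      = ∑' k, ∑' l, ∑' m, x l * x m * (y (k - l) * y (k - m)) := by
        refine tsum_congr fun k => ?_
        rw [sq, ← ENNReal.tsum_mul_right]
        refine tsum_congr fun l => ?_
        rw [← ENNReal.tsum_mul_left]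
        exact tsum_congr fun m => by ring
    _ = ∑' l, ∑' m, x l * x m * ∑' k, y (k - l) * y (k - m) := by
        rw [ENNReal.tsum_comm]
        refine tsum_congr fun l => ?_
        rw [ENNReal.tsum_comm]
        exact tsum_congr fun m => ENNReal.tsum_mul_left
    _ ≤ ∑' l, ∑' m, x l * x m * (2 * ∑' k, y k ^ 2) := by
        gcongr with l m
        exact hcorr l m
    _ = 2 * (∑' l, x l) ^ 2 * ∑' k, y k ^ 2 := by
        simp only [ENNReal.tsum_mul_right, ENNReal.tsum_mul_left]
        ring

/-- The weighted convolution estimate behind the algebra property of `H^s`. -/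
lemma tsum_weighted_convolution_sq_le (ω x y : I → ℝ≥0∞) :
    ∑' k, (∑' l, (ω l + ω (k - l)) * (x l * y (k - l))) ^ 2 ≤
      12 * (∑' l, ω l ^ 2) * (∑' l, x l ^ 2) * ∑' l, y l ^ 2 := by
  -- The reflection `l ↦ k - l` in the second half moves the weight to index `l`. Each half is then
  -- an `ℓ¹ * ℓ²` convolution, as `ωx` and `ωy` are in `ℓ¹` whenever the sums on the right are
  -- finite.
  have h1 : ∀ k, ∑' l, (ω l + ω (k - l)) * (x l * y (k - l)) =
      (∑' l, (ω l * x l) * y (k - l)) + ∑' l, (ω l * y l) * x (k - l) := fun k => by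
    rw [← (Equiv.subLeft k).tsum_eq (fun l => (ω l * y l) * x (k - l)), ← ENNReal.tsum_add]
    refine tsum_congr fun l => ?_
    simp only [Equiv.subLeft_apply, sub_sub_cancel]
    ring
  calc ∑' k, (∑' l, (ω l + ω (k - l)) * (x l * y (k - l))) ^ 2
      ≤ ∑' k, 3 * ((∑' l, (ω l * x l) * y (k - l)) ^ 2 +
          (∑' l, (ω l * y l) * x (k - l)) ^ 2) := by
        refine ENNReal.tsum_le_tsum fun k => ?_
        rw [h1]
        exact ennreal_add_sq_le _ _
    _ ≤ 3 * (2 * (∑' l, ω l * x l) ^ 2 * (∑' l, y l ^ 2) +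
          2 * (∑' l, ω l * y l) ^ 2 * ∑' l, x l ^ 2) := by
        rw [ENNReal.tsum_mul_left, ENNReal.tsum_add]
        gcongr <;> exact tsum_convolution_sq_le _ _
    _ ≤ 3 * (2 * ((∑' l, ω l ^ 2) * ∑' l, x l ^ 2) * (∑' l, y l ^ 2) +
          2 * ((∑' l, ω l ^ 2) * ∑' l, y l ^ 2) * ∑' l, x l ^ 2) := by
        gcongr <;> exact ennreal_tsum_mul_sq_le _ _
    _ = 12 * (∑' l, ω l ^ 2) * (∑' l, x l ^ 2) * ∑' l, y l ^ 2 := by ring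

end Convolution

/-! ### `ℓ²` norms as sums in `[0, ∞]`. -/

section SquareSummable

variable {I : Type*}

lemma memℓp_two_iff_tsum_enorm {a : I → ℂ} : Memℓp a 2 ↔ ∑' i, ‖a i‖ₑ ^ 2 ≠ ∞ := by
  rw [memℓp_gen_iff (by simp)]
  simp only [ENNReal.toReal_ofNat, Real.rpow_ofNat]
  have : ∀ i, ‖a i‖ₑ ^ 2 = ((‖a i‖₊ ^ 2 : ℝ≥0) : ℝ≥0∞) := fun i => by
    rw [enorm_eq_nnnorm]; push_cast; rfl
  simp only [this, ENNReal.tsum_coe_ne_top_iff_summable, ← NNReal.summable_coe]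
  push_cast
  rfl

lemma tsum_enorm_sq (a : lp (fun _ : I => ℂ) 2) : ∑' i, ‖a i‖ₑ ^ 2 = ‖a‖ₑ ^ 2 := by
  have h := lp.hasSum_norm (p := 2) (by simp) a
  simp only [ENNReal.toReal_ofNat, Real.rpow_ofNat] at h
  have h2 : ∀ i, ‖a i‖ₑ ^ 2 = ENNReal.ofReal (‖a i‖ ^ 2) := fun i => by
    rw [ENNReal.ofReal_pow (norm_nonneg _), ofReal_norm]
  simp only [h2]
  rw [← ENNReal.ofReal_tsum_of_nonneg (fun _ => by positivity) h.summable, h.tsum_eq,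
    ENNReal.ofReal_pow (norm_nonneg _), ofReal_norm]

end SquareSummable

/-! ### Bilinear convolution forms on `ℓ²`. -/

section ConvolutionForm

variable {I : Type*} [AddCommGroup I] {K : I → I → ℂ} {ω : I → ℝ≥0}

/-- With absolute values inside the sum, one estimate yields both the convergence of the series and
the bound on the form. -/
lemma tsum_kernel_sq_le (hK : ∀ k l, ‖K k l‖₊ ≤ ω l + ω (k - l))
    (a b : lp (fun _ : I => ℂ) 2) :
    ∑' k, (∑' l, ‖K k l * (a l * b (k - l))‖ₑ) ^ 2 ≤
      12 * (∑' l, (ω l : ℝ≥0∞) ^ 2) * ‖a‖ₑ ^ 2 * ‖b‖ₑ ^ 2 := by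
  rw [← tsum_enorm_sq a, ← tsum_enorm_sq b]
  refine le_trans ?_ (tsum_weighted_convolution_sq_le (fun l => (ω l : ℝ≥0∞))
    (fun l => ‖a l‖ₑ) fun l => ‖b l‖ₑ)
  gcongr with k l
  rw [enorm_mul, enorm_mul]
  gcongr
  rw [enorm_eq_nnnorm]
  exact_mod_cast hK k l

lemma tsum_weight_sq_ne_top {I : Type*} {ω : I → ℝ≥0} (hω : Summable fun l => ω l ^ 2) :
    ∑' l, (ω l : ℝ≥0∞) ^ 2 ≠ ∞ := by
  have := ENNReal.tsum_coe_ne_top_iff_summable.2 hω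
  push_cast at this
  exact this

lemma tsum_kernel_sq_ne_top (hK : ∀ k l, ‖K k l‖₊ ≤ ω l + ω (k - l))
    (hω : Summable fun l => ω l ^ 2) (a b : lp (fun _ : I => ℂ) 2) :
    ∑' k, (∑' l, ‖K k l * (a l * b (k - l))‖ₑ) ^ 2 ≠ ∞ := by
  refine ne_top_of_le_ne_top ?_ (tsum_kernel_sq_le hK a b)
  have := tsum_weight_sq_ne_top hω
  finiteness

lemma summable_kernel (hK : ∀ k l, ‖K k l‖₊ ≤ ω l + ω (k - l))
    (hω : Summable fun l => ω l ^ 2) (a b : lp (fun _ : I => ℂ) 2) (k : I) :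
    Summable fun l => K k l * (a l * b (k - l)) := by
  have h := ENNReal.ne_top_of_tsum_ne_top (tsum_kernel_sq_ne_top hK hω a b) k
  have h' : ∑' l, ‖K k l * (a l * b (k - l))‖ₑ ≠ ∞ := by
    intro h0
    rw [h0] at h
    simp at h
  simp only [enorm_eq_nnnorm] at h'
  exact Summable.of_norm (NNReal.summable_coe.2 (ENNReal.tsum_coe_ne_top_iff_summable.1 h'))

lemma enorm_tsum_kernel_le (hK : ∀ k l, ‖K k l‖₊ ≤ ω l + ω (k - l))
    (a b : lp (fun _ : I => ℂ) 2) :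
    ∑' k, ‖∑' l, K k l * (a l * b (k - l))‖ₑ ^ 2 ≤
      12 * (∑' l, (ω l : ℝ≥0∞) ^ 2) * ‖a‖ₑ ^ 2 * ‖b‖ₑ ^ 2 := by
  refine le_trans ?_ (tsum_kernel_sq_le hK a b)
  gcongr
  exact enorm_tsum_le_tsum_enorm

/-- The weighted convolution `k ↦ ∑ₗ K(k, l) a(l) b(k - l)` as a map `ℓ² × ℓ² → ℓ²`. -/
noncomputable def convolution (hK : ∀ k l, ‖K k l‖₊ ≤ ω l + ω (k - l))
    (hω : Summable fun l => ω l ^ 2) (a b : lp (fun _ : I => ℂ) 2) : lp (fun _ : I => ℂ) 2 :=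
  ⟨fun k => ∑' l, K k l * (a l * b (k - l)), memℓp_two_iff_tsum_enorm.2 <| by
    refine ne_top_of_le_ne_top ?_ (enorm_tsum_kernel_le hK a b)
    have := tsum_weight_sq_ne_top hω
    finiteness⟩

variable (hK : ∀ k l, ‖K k l‖₊ ≤ ω l + ω (k - l)) (hω : Summable fun l => ω l ^ 2)

lemma convolution_apply (a b : lp (fun _ : I => ℂ) 2) (k : I) :
    convolution hK hω a b k = ∑' l, K k l * (a l * b (k - l)) := rfl

lemma norm_convolution_le (a b : lp (fun _ : I => ℂ) 2) :
    ‖convolution hK hω a b‖ ≤ NNReal.sqrt (12 * ∑' l, ω l ^ 2) * ‖a‖ * ‖b‖ := by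
  have h := enorm_tsum_kernel_le hK a b
  have h1 : ∑' k, ‖∑' l, K k l * (a l * b (k - l))‖ₑ ^ 2 = ‖convolution hK hω a b‖ₑ ^ 2 :=
    tsum_enorm_sq (convolution hK hω a b)
  have h2 : ∑' l, (ω l : ℝ≥0∞) ^ 2 = ((∑' l, ω l ^ 2 : ℝ≥0) : ℝ≥0∞) := by
    rw [ENNReal.coe_tsum hω]
    push_cast
    rfl
  rw [h1, h2, enorm_eq_nnnorm, enorm_eq_nnnorm, enorm_eq_nnnorm] at h
  have h3 : ‖convolution hK hω a b‖₊ ^ 2 ≤ 12 * (∑' l, ω l ^ 2) * ‖a‖₊ ^ 2 * ‖b‖₊ ^ 2 := by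
    exact_mod_cast h
  have h4 : ‖convolution hK hω a b‖₊ ≤ NNReal.sqrt (12 * ∑' l, ω l ^ 2) * ‖a‖₊ * ‖b‖₊ := by
    rw [← pow_le_pow_iff_left₀ zero_le zero_le two_ne_zero, mul_pow, mul_pow,
      NNReal.sq_sqrt]
    exact h3
  simpa only [NNReal.coe_mul, coe_nnnorm] using NNReal.coe_le_coe.2 h4

/-- Bilinearity turns the difference of two quadratic values into terms linear in `a - b`: this is
the source of the Lipschitz bound. -/
lemma convolution_self_sub (a b : lp (fun _ : I => ℂ) 2) :
    convolution hK hω a a - convolution hK hω b b =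
      convolution hK hω (a - b) a + convolution hK hω b (a - b) := by
  ext k
  simp only [lp.coeFn_sub, lp.coeFn_add, Pi.sub_apply, Pi.add_apply, convolution_apply]
  rw [← (summable_kernel hK hω a a k).tsum_sub (summable_kernel hK hω b b k),
    ← Summable.tsum_add]
  · exact tsum_congr fun l => by ring
  · simpa using summable_kernel hK hω (a - b) a k
  · simpa using summable_kernel hK hω b (a - b) k

lemma quadraticLipschitz_convolution :
    QuadraticLipschitz (fun a => -convolution hK hω a a) (NNReal.sqrt (12 * ∑' l, ω l ^ 2)) := by
  intro a b
  rw [neg_sub_neg, norm_sub_rev, convolution_self_sub]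
  refine (norm_add_le _ _).trans ((add_le_add (norm_convolution_le hK hω _ _)
    (norm_convolution_le hK hω _ _)).trans (le_of_eq ?_))
  ring

lemma convolution_zero : -convolution hK hω 0 0 = 0 := by
  have := norm_convolution_le hK hω 0 0
  rw [norm_zero, mul_zero] at this
  rw [norm_le_zero_iff.1 this, neg_zero]

end ConvolutionForm

/-! ### The kernel of the equation and its bounds. -/

section Kernel

lemma freqNorm_eq_norm (k : Fin 2 → ℤ) :
    freqNorm k = ‖((k 0 : ℝ) : ℂ) + ((k 1 : ℝ) : ℂ) * Complex.I‖ := by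
  rw [Complex.norm_add_mul_I, freqNorm]

lemma freqNorm_le_add (k l : Fin 2 → ℤ) : freqNorm k ≤ freqNorm l + freqNorm (k - l) := by
  rw [freqNorm_eq_norm, freqNorm_eq_norm, freqNorm_eq_norm]
  refine le_trans (le_of_eq ?_) (norm_add_le _ _)
  congr 1
  simp only [Pi.sub_apply]
  push_cast
  ring

lemma norm_le_freqNorm (k : Fin 2 → ℤ) : ‖k‖ ≤ freqNorm k := by
  rw [pi_norm_le_iff_of_nonneg (freqNorm_nonneg k)]
  intro j
  rw [Int.norm_eq_abs]
  exact abs_apply_le_freqNorm k j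

/-- Lagrange's identity: `(l × k)² + (l · k)² = |l|² |k|²`. -/
lemma abs_interaction_le (k l : Fin 2 → ℤ) : |interaction k l| ≤ freqNorm k := by
  rw [interaction, abs_div, abs_of_nonneg (freqNorm_nonneg l)]
  refine div_le_of_le_mul₀ (freqNorm_nonneg l) (freqNorm_nonneg k) ?_
  refine abs_le_of_sq_le_sq ?_ (mul_nonneg (freqNorm_nonneg k) (freqNorm_nonneg l))
  rw [mul_pow, freqNorm_sq, freqNorm_sq]
  nlinarith [sq_nonneg ((l 0 : ℝ) * k 0 + (l 1 : ℝ) * k 1)]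

lemma interaction_neg (k l : Fin 2 → ℤ) : interaction (-k) (-l) = interaction k l := by
  simp [interaction, freqNorm_neg]

lemma interaction_zero_left (l : Fin 2 → ℤ) : interaction 0 l = 0 := by
  simp [interaction]

lemma interaction_zero_right (k : Fin 2 → ℤ) : interaction k 0 = 0 := by
  simp [interaction]

lemma interaction_self (k : Fin 2 → ℤ) : interaction k k = 0 := by
  rw [interaction, mul_comm, sub_self, zero_div]

/-- The kernel of the quadratic nonlinearity in the unknowns `|k|^s θ̂(k)`. -/
noncomputable def kernel (μ α s : ℝ) (k l : Fin 2 → ℤ) : ℝ :=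
  freqNorm k ^ s / (1 + μ * freqNorm k ^ (2 * α)) * interaction k l *
    (freqNorm l ^ (-s) * freqNorm (k - l) ^ (-s))

/-- The square summable weight dominating the kernel. -/
noncomputable def kernelWeight (μ s : ℝ) (k : Fin 2 → ℤ) : ℝ≥0 :=
  Real.toNNReal (μ⁻¹ * 2 ^ s * freqNorm k ^ (-s))

lemma kernel_neg (μ α s : ℝ) (k l : Fin 2 → ℤ) : kernel μ α s (-k) (-l) = kernel μ α s k l := by
  have : -k - -l = -(k - l) := by abel
  rw [kernel, kernel, interaction_neg, this, freqNorm_neg, freqNorm_neg, freqNorm_neg]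

variable {μ α s : ℝ}

/-- Since `p` is at most twice the larger of `q` and `r`, the factor `p ^ s` cancels the negative
power of that one. -/
lemma rpow_mul_rpow_neg_le {p q r : ℝ} (hs : 0 ≤ s) (hp : 0 ≤ p) (hq : 0 < q) (hr : 0 < r)
    (h : p ≤ q + r) : p ^ s * (q ^ (-s) * r ^ (-s)) ≤ 2 ^ s * (q ^ (-s) + r ^ (-s)) := by
  wlog hqr : q ≤ r generalizing q r
  · have := this hr hq (by linarith) (le_of_not_ge hqr)
    rwa [mul_comm (q ^ (-s)), add_comm (q ^ (-s))]
  have h1 : p ^ s ≤ 2 ^ s * r ^ s := by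
    rw [← Real.mul_rpow zero_le_two hr.le]
    exact Real.rpow_le_rpow hp (by linarith) hs
  have h2 : r ^ s * r ^ (-s) = 1 := by
    rw [← Real.rpow_add hr, add_neg_cancel, Real.rpow_zero]
  calc p ^ s * (q ^ (-s) * r ^ (-s)) ≤ 2 ^ s * r ^ s * (q ^ (-s) * r ^ (-s)) := by gcongr
    _ = 2 ^ s * (q ^ (-s) * (r ^ s * r ^ (-s))) := by ring
    _ = 2 ^ s * q ^ (-s) := by rw [h2, mul_one]
    _ ≤ 2 ^ s * (q ^ (-s) + r ^ (-s)) := by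
      gcongr
      linarith [Real.rpow_nonneg hr.le (-s)]

lemma one_add_symbol_pos (hμ : 0 < μ) (k : Fin 2 → ℤ) : 0 < 1 + μ * freqNorm k ^ (2 * α) := by
  have := Real.rpow_nonneg (freqNorm_nonneg k) (2 * α)
  positivity

lemma abs_kernel_le (hμ : 0 < μ) (hα : 1 / 2 ≤ α) (hs : 1 < s) (k l : Fin 2 → ℤ) :
    |kernel μ α s k l| ≤ μ⁻¹ * 2 ^ s * (freqNorm l ^ (-s) + freqNorm (k - l) ^ (-s)) := by
  have hnn : ∀ m : Fin 2 → ℤ, 0 ≤ freqNorm m ^ (-s) := fun m =>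
    Real.rpow_nonneg (freqNorm_nonneg m) _
  have hrhs : 0 ≤ μ⁻¹ * 2 ^ s * (freqNorm l ^ (-s) + freqNorm (k - l) ^ (-s)) := by
    have := hnn l
    have := hnn (k - l)
    positivity
  have hz : (0 : ℝ) ^ (-s) = 0 := Real.zero_rpow (by linarith)
  -- The interaction vanishes when `k`, `l` or `k - l` is zero; elsewhere all three lengths are at
  -- least `1`.
  rcases eq_or_ne k 0 with rfl | hk
  · simpa [kernel, interaction_zero_left] using hrhs
  rcases eq_or_ne l 0 with rfl | hl
  · simpa [kernel, interaction_zero_right] using hrhs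
  rcases eq_or_ne (k - l) 0 with hkl | hkl
  · rw [sub_eq_zero.1 hkl, kernel, interaction_self, mul_zero, zero_mul, abs_zero]
    have := hnn l
    have := hnn (l - l)
    positivity
  have hk1 := one_le_freqNorm hk
  have hl1 := one_le_freqNorm hl
  have hkl1 := one_le_freqNorm hkl
  have hpos := one_add_symbol_pos (α := α) hμ k
  -- Here `α ≥ 1/2` lets the regularization absorb the full derivative.
  have hsym : freqNorm k / (1 + μ * freqNorm k ^ (2 * α)) ≤ μ⁻¹ := by
    rw [div_le_iff₀ hpos, mul_add, mul_one, inv_mul_cancel_left₀ hμ.ne']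
    have : freqNorm k ^ (1 : ℝ) ≤ freqNorm k ^ (2 * α) :=
      Real.rpow_le_rpow_of_exponent_le hk1 (by linarith)
    rw [Real.rpow_one] at this
    linarith [inv_pos.2 hμ]
  have hks : 0 ≤ freqNorm k ^ s := Real.rpow_nonneg (freqNorm_nonneg k) _
  have hmul : 0 ≤ freqNorm l ^ (-s) * freqNorm (k - l) ^ (-s) := mul_nonneg (hnn _) (hnn _)
  rw [kernel, abs_mul, abs_mul, abs_of_nonneg (div_nonneg hks hpos.le), abs_of_nonneg hmul]
  calc freqNorm k ^ s / (1 + μ * freqNorm k ^ (2 * α)) * |interaction k l| *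
        (freqNorm l ^ (-s) * freqNorm (k - l) ^ (-s))
      ≤ freqNorm k ^ s / (1 + μ * freqNorm k ^ (2 * α)) * freqNorm k *
        (freqNorm l ^ (-s) * freqNorm (k - l) ^ (-s)) := by
        gcongr
        exact abs_interaction_le k l
    _ = freqNorm k / (1 + μ * freqNorm k ^ (2 * α)) *
        (freqNorm k ^ s * (freqNorm l ^ (-s) * freqNorm (k - l) ^ (-s))) := by ring
    _ ≤ μ⁻¹ * (2 ^ s * (freqNorm l ^ (-s) + freqNorm (k - l) ^ (-s))) := by
        refine mul_le_mul hsym ?_ (mul_nonneg hks hmul) (inv_pos.2 hμ).le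
        exact rpow_mul_rpow_neg_le (by linarith) (freqNorm_nonneg k) (by linarith) (by linarith)
          (freqNorm_le_add k l)
    _ = _ := by ring

lemma kernelWeight_coe (hμ : 0 < μ) (k : Fin 2 → ℤ) :
    (kernelWeight μ s k : ℝ) = μ⁻¹ * 2 ^ s * freqNorm k ^ (-s) := by
  have := Real.rpow_nonneg (freqNorm_nonneg k) (-s)
  exact Real.coe_toNNReal _ (by positivity)

lemma nnnorm_kernel_le (hμ : 0 < μ) (hα : 1 / 2 ≤ α) (hs : 1 < s) (k l : Fin 2 → ℤ) :
    ‖(kernel μ α s k l : ℂ)‖₊ ≤ kernelWeight μ s l + kernelWeight μ s (k - l) := by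
  rw [← NNReal.coe_le_coe, coe_nnnorm, Complex.norm_real, Real.norm_eq_abs, NNReal.coe_add,
    kernelWeight_coe hμ, kernelWeight_coe hμ, ← mul_add]
  exact abs_kernel_le hμ hα hs k l

/-- Comparison with the lattice sum of `‖k‖ ^ (-2s)` in the sup norm, convergent on `ℤ²` as `2s >
2`. The term `k = 0` is zero by the convention `0 ^ (-s) = 0`. -/
lemma summable_freqNorm_rpow (hs : 1 < s) : Summable fun k => (freqNorm k ^ (-s)) ^ 2 := by
  refine Summable.of_nonneg_of_le (fun _ => by positivity) (fun k => ?_)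
    (EisensteinSeries.summable_one_div_norm_rpow (k := 2 * s) (by linarith))
  rw [← Real.rpow_natCast, ← Real.rpow_mul (freqNorm_nonneg k)]
  rcases eq_or_ne k 0 with rfl | hk
  · rw [freqNorm_zero, norm_zero, Real.zero_rpow (by push_cast; linarith),
      Real.zero_rpow (by linarith)]
  · rw [show -s * ((2 : ℕ) : ℝ) = -(2 * s) by push_cast; ring]
    exact Real.rpow_le_rpow_of_nonpos (norm_pos_iff.2 hk) (norm_le_freqNorm k) (by linarith)

lemma summable_kernelWeight_sq (hμ : 0 < μ) (hs : 1 < s) :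
    Summable fun k => kernelWeight μ s k ^ 2 := by
  rw [← NNReal.summable_coe]
  refine ((summable_freqNorm_rpow hs).mul_left ((μ⁻¹ * 2 ^ s) ^ 2)).congr fun k => ?_
  rw [NNReal.coe_pow, kernelWeight_coe hμ, mul_pow _ (freqNorm k ^ (-s))]

/-- Square summable families of complex numbers indexed by the frequencies. -/
abbrev Seq : Type := lp (fun _ : Fin 2 → ℤ => ℂ) 2

/-- The vector field on `ℓ²` to which the equation reduces in the unknowns `|k|^s θ̂(k)`. -/
noncomputable def field (hμ : 0 < μ) (hα : 1 / 2 ≤ α) (hs : 1 < s) (a : Seq) : Seq :=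
  -convolution (nnnorm_kernel_le hμ hα hs) (summable_kernelWeight_sq hμ hs) a a

lemma field_apply (hμ : 0 < μ) (hα : 1 / 2 ≤ α) (hs : 1 < s) (a : Seq) (k : Fin 2 → ℤ) :
    field hμ hα hs a k = -∑' l, (kernel μ α s k l : ℂ) * (a l * a (k - l)) := rfl

lemma field_zero (hμ : 0 < μ) (hα : 1 / 2 ≤ α) (hs : 1 < s) : field hμ hα hs 0 = 0 :=
  convolution_zero _ _

/-- The Lipschitz constant of the vector field. -/
noncomputable def fieldConst (μ s : ℝ) : ℝ≥0 := NNReal.sqrt (12 * ∑' l, kernelWeight μ s l ^ 2)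

lemma quadraticLipschitz_field (hμ : 0 < μ) (hα : 1 / 2 ≤ α) (hs : 1 < s) :
    QuadraticLipschitz (field hμ hα hs) (fieldConst μ s) :=
  quadraticLipschitz_convolution _ _

lemma field_apply_zero (hμ : 0 < μ) (hα : 1 / 2 ≤ α) (hs : 1 < s) (a : Seq) :
    field hμ hα hs a 0 = 0 := by
  simp [field_apply, kernel, interaction_zero_left]

end Kernel

/-! ### Invariance of the real-valued functions. -/

section Hermitian

variable {μ α s : ℝ}

/-- The coefficient families of real-valued functions. -/
noncomputable def hermitian : Submodule ℝ Seq where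
  carrier := {a | ∀ k, a (-k) = conj (a k)}
  add_mem' := fun ha hb k => by
    simp only [lp.coeFn_add, Pi.add_apply, map_add, ha k, hb k]
  zero_mem' := fun k => by simp
  smul_mem' := fun c a ha k => by
    simp only [lp.coeFn_smul, Pi.smul_apply, ha k, Complex.real_smul, map_mul, Complex.conj_ofReal]

lemma mem_hermitian {a : Seq} : a ∈ hermitian ↔ ∀ k, a (-k) = conj (a k) := Iff.rfl

lemma isClosed_hermitian : IsClosed (hermitian : Set Seq) := by
  have : (hermitian : Set Seq) = ⋂ k, {a : Seq | a (-k) = conj (a k)} := by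
    ext a
    simp [mem_hermitian]
  rw [this]
  refine isClosed_iInter fun k => isClosed_eq ?_ ?_
  · exact (lp.evalCLM ℝ (fun _ : Fin 2 → ℤ => ℂ) 2 (-k)).continuous
  · exact Complex.continuous_conj.comp (lp.evalCLM ℝ (fun _ : Fin 2 → ℤ => ℂ) 2 k).continuous

/-- The kernel is real and unchanged under `(k, l) ↦ (-k, -l)`. -/
lemma field_mem_hermitian (hμ : 0 < μ) (hα : 1 / 2 ≤ α) (hs : 1 < s) {a : Seq}
    (ha : a ∈ hermitian) : field hμ hα hs a ∈ hermitian := by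
  intro k
  rw [field_apply, field_apply, map_neg, Complex.conj_tsum, ← (Equiv.neg _).tsum_eq]
  congr 1
  refine tsum_congr fun l => ?_
  have : -k - -l = -(k - l) := by abel
  rw [Equiv.neg_apply, kernel_neg, this, ha l, ha (k - l), map_mul, map_mul, Complex.conj_ofReal]

lemma exists_hermitian_isMildSolution (hμ : 0 < μ) (hα : 1 / 2 ≤ α) (hs : 1 < s) {x₀ : Seq}
    (hx₀ : x₀ ∈ hermitian) {b : ℝ≥0} (hb : ‖x₀‖ ≤ b) :
    ∃ c, IsMildSolution (field hμ hα hs) x₀ (existenceTime (fieldConst μ s) b) c ∧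
      ∀ t, c t ∈ hermitian :=
  exists_isMildSolution_mem (quadraticLipschitz_field hμ hα hs) (field_zero hμ hα hs) hermitian
    isClosed_hermitian (fun _ ha => field_mem_hermitian hμ hα hs ha) hx₀ hb

end Hermitian

/-! ### From `H^s` to `ℓ²`. -/

section SobolevSequence

variable {μ α s : ℝ}

lemma sobolevNorm_eq (s : ℝ) (f : L2) :
    sobolevNorm s f =
      (∑' k, ‖((freqNorm k ^ s : ℝ) : ℂ) * hat f k‖ₑ ^ 2) ^ (1 / 2 : ℝ) := by
  rw [sobolevNorm]
  congr 1
  refine tsum_congr fun k => ?_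
  have h := Real.rpow_nonneg (freqNorm_nonneg k) s
  rw [← ofReal_norm, ← ENNReal.ofReal_pow (norm_nonneg _), norm_mul, mul_pow, Complex.norm_real,
    Real.norm_of_nonneg h, mul_comm 2 s, Real.rpow_mul (freqNorm_nonneg k), Real.rpow_ofNat]

lemma sobolevNorm_lt_top_iff (f : L2) :
    sobolevNorm s f < ∞ ↔ Memℓp (fun k => ((freqNorm k ^ s : ℝ) : ℂ) * hat f k) 2 := by
  rw [memℓp_two_iff_tsum_enorm, sobolevNorm_eq, ENNReal.rpow_lt_top_iff_of_pos (by norm_num),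
    lt_top_iff_ne_top]

open Classical in
/-- The family `|k|^s f̂(k)` for `f ∈ H^s` (and `0` otherwise). -/
noncomputable def toSeq (s : ℝ) (f : L2) : Seq :=
  if h : Memℓp (fun k => ((freqNorm k ^ s : ℝ) : ℂ) * hat f k) 2 then ⟨_, h⟩ else 0

lemma toSeq_apply {f : L2} (hf : sobolevNorm s f < ∞) (k : Fin 2 → ℤ) :
    toSeq s f k = ((freqNorm k ^ s : ℝ) : ℂ) * hat f k := by
  rw [toSeq, dif_pos ((sobolevNorm_lt_top_iff f).1 hf)]

lemma enorm_toSeq {f : L2} (hf : sobolevNorm s f < ∞) : ‖toSeq s f‖ₑ = sobolevNorm s f := by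
  have h := tsum_enorm_sq (toSeq s f)
  simp only [toSeq_apply hf] at h
  rw [sobolevNorm_eq, h, ← ENNReal.rpow_natCast, ← ENNReal.rpow_mul]
  norm_num

lemma toSeq_mem_hermitian {f : L2} (hf : sobolevNorm s f < ∞) : toSeq s f ∈ hermitian := by
  intro k
  rw [toSeq_apply hf, toSeq_apply hf, hat_neg_freq, freqNorm_neg, map_mul, Complex.conj_ofReal]

lemma freqNorm_rpow_neg_mul_rpow {k : Fin 2 → ℤ} (hk : k ≠ 0) :
    freqNorm k ^ (-s) * freqNorm k ^ s = 1 := by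
  have := one_le_freqNorm hk
  rw [← Real.rpow_add (by linarith), neg_add_cancel, Real.rpow_zero]

lemma hat_eq_of_toSeq {f : L2} (hf : sobolevNorm s f < ∞) {k : Fin 2 → ℤ} (hk : k ≠ 0) :
    hat f k = ((freqNorm k ^ (-s) : ℝ) : ℂ) * toSeq s f k := by
  rw [toSeq_apply hf, ← mul_assoc, ← Complex.ofReal_mul, freqNorm_rpow_neg_mul_rpow hk,
    Complex.ofReal_one, one_mul]

lemma summable_gradient (hs : 1 < s) {f : L2} (hf : sobolevNorm s f < ∞) :
    Summable fun k => (freqNorm k * ‖hat f k‖) ^ 2 := by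
  have h := (memℓp_gen_iff (p := 2) (by simp)).1 ((sobolevNorm_lt_top_iff f).1 hf)
  simp only [ENNReal.toReal_ofNat, Real.rpow_ofNat] at h
  refine Summable.of_nonneg_of_le (fun _ => by positivity) (fun k => ?_) h
  rw [norm_mul, Complex.norm_real,
    Real.norm_of_nonneg (Real.rpow_nonneg (freqNorm_nonneg k) s)]
  have hnn := freqNorm_nonneg k
  gcongr
  rcases eq_or_ne k 0 with rfl | hk
  · rw [freqNorm_zero, Real.zero_rpow (by linarith)]
  · calc freqNorm k = freqNorm k ^ (1 : ℝ) := (Real.rpow_one _).symm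
      _ ≤ freqNorm k ^ s := Real.rpow_le_rpow_of_exponent_le (one_le_freqNorm hk) hs.le

/-- The mean `f̂(0)`, which `toSeq` forgets, enters only through `l = 0` and `l = k`, where the
interaction vanishes. -/
lemma field_toSeq (hμ : 0 < μ) (hα : 1 / 2 ≤ α) (hs : 1 < s) {f : L2}
    (hf : sobolevNorm s f < ∞) (k : Fin 2 → ℤ) :
    field hμ hα hs (toSeq s f) k =
      ((-(freqNorm k ^ s / (1 + μ * freqNorm k ^ (2 * α))) : ℝ) : ℂ) * coeff (advection f) k := by
  rw [field_apply, ← (hasSum_coeff_advection (summable_gradient hs hf) k).tsum_eq,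
    Complex.ofReal_neg, neg_mul, ← tsum_mul_left]
  congr 1
  refine tsum_congr fun l => ?_
  rw [kernel]
  rcases eq_or_ne l 0 with rfl | hl
  · simp [interaction_zero_right]
  rcases eq_or_ne (k - l) 0 with hkl | hkl
  · rw [sub_eq_zero.1 hkl, interaction_self]
    simp
  rw [hat_eq_of_toSeq hf hl, hat_eq_of_toSeq hf hkl]
  push_cast
  ring

lemma coeff_advection_zero (hs : 1 < s) {f : L2} (hf : sobolevNorm s f < ∞) :
    coeff (advection f) 0 = 0 := by
  rw [← (hasSum_coeff_advection (summable_gradient hs hf) 0).tsum_eq]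
  simp [interaction_zero_left]

lemma coeff_advection_eq (hμ : 0 < μ) (hα : 1 / 2 ≤ α) (hs : 1 < s) {f : L2}
    (hf : sobolevNorm s f < ∞) (k : Fin 2 → ℤ) :
    coeff (advection f) k =
      ((-((1 + μ * freqNorm k ^ (2 * α)) * freqNorm k ^ (-s)) : ℝ) : ℂ) *
        field hμ hα hs (toSeq s f) k := by
  rcases eq_or_ne k 0 with rfl | hk
  · rw [coeff_advection_zero hs hf, field_apply_zero, mul_zero]
  · rw [field_toSeq hμ hα hs hf, ← mul_assoc, ← Complex.ofReal_mul]
    have h1 := (one_add_symbol_pos (α := α) hμ k).ne'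
    have h2 := freqNorm_rpow_neg_mul_rpow (s := s) hk
    rw [show -((1 + μ * freqNorm k ^ (2 * α)) * freqNorm k ^ (-s)) *
        -(freqNorm k ^ s / (1 + μ * freqNorm k ^ (2 * α))) = 1 by
      rw [neg_mul_neg]; field_simp; exact h2, Complex.ofReal_one, one_mul]

end SobolevSequence

/-! ### From `ℓ²` back to real functions. -/

section Reconstruction

variable {s : ℝ}

lemma freqNorm_rpow_neg_le_one (hs : 0 < s) (k : Fin 2 → ℤ) : freqNorm k ^ (-s) ≤ 1 := by
  rcases eq_or_ne k 0 with rfl | hk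
  · rw [freqNorm_zero, Real.zero_rpow (by linarith)]
    exact zero_le_one
  · exact Real.rpow_le_one_of_one_le_of_nonpos (one_le_freqNorm hk) (by linarith)

lemma norm_rpow_neg_mul_le (hs : 0 < s) (a : Seq) (k : Fin 2 → ℤ) :
    ‖((freqNorm k ^ (-s) : ℝ) : ℂ) * a k‖ ≤ ‖a k‖ := by
  rw [norm_mul, Complex.norm_real,
    Real.norm_of_nonneg (Real.rpow_nonneg (freqNorm_nonneg k) _)]
  exact mul_le_of_le_one_left (norm_nonneg _) (freqNorm_rpow_neg_le_one hs k)

lemma memℓp_rpow_neg_mul (hs : 0 < s) (a : Seq) :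
    Memℓp (fun k => ((freqNorm k ^ (-s) : ℝ) : ℂ) * a k) 2 := by
  have h := (memℓp_gen_iff (p := 2) (by simp)).1 (lp.memℓp a)
  rw [memℓp_gen_iff (by simp)]
  simp only [ENNReal.toReal_ofNat, Real.rpow_ofNat] at h ⊢
  refine Summable.of_nonneg_of_le (fun _ => by positivity) (fun k => ?_) h
  gcongr
  exact norm_rpow_neg_mul_le hs a k

/-- Multiplication of the `k`-th entry by `|k|^{-s}`. -/
noncomputable def smoothing (hs : 0 < s) : Seq →L[ℝ] Seq :=
  LinearMap.mkContinuous
    { toFun := fun a => ⟨_, memℓp_rpow_neg_mul hs a⟩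
      map_add' := fun a b => by
        ext k
        exact mul_add _ _ _
      map_smul' := fun c a => by
        ext k
        simp [mul_left_comm] } 1 fun a => by
    rw [one_mul]
    exact lp.norm_mono (by simp) (norm_rpow_neg_mul_le hs a)

lemma smoothing_apply (hs : 0 < s) (a : Seq) (k : Fin 2 → ℤ) :
    smoothing hs a k = ((freqNorm k ^ (-s) : ℝ) : ℂ) * a k := rfl

/-- The real-valued function with Fourier coefficients `|k|^{-s} a(k)`, for hermitian `a`. -/
noncomputable def ofSeq (hs : 0 < s) : Seq →L[ℝ] L2 :=
  ((Complex.reCLM.compLpL 2 (volume : Measure Torus)).comp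
    ((waveBasis.repr.symm.toContinuousLinearEquiv.toContinuousLinearMap).restrictScalars ℝ)).comp
      (((2 * π) : ℝ) • smoothing hs)

lemma coeff_re (g : Lp ℂ 2 (volume : Measure Torus)) (k : Fin 2 → ℤ) :
    hat (Complex.reCLM.compLp g) k = (coeff g k + conj (coeff g (-k))) / 2 := by
  have hint : ∀ h : Torus → ℂ, MemLp h 2 (volume : Measure Torus) →
      Integrable (fun x => h x * wave (-k) x) (volume : Measure Torus) := by
    intro h hh
    have h1 := hh.integrable (by norm_num)
    refine h1.mono (h1.1.mul (wave (-k)).continuous.aestronglyMeasurable)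
      (ae_of_all _ fun x => ?_)
    rw [norm_mul, wave_norm, mul_one]
  have hconj : MemLp (fun x => conj (g x)) 2 (volume : Measure Torus) := (Lp.memLp g).star
  have h1 : hat (Complex.reCLM.compLp g) k = coeff (fun x => (g x + conj (g x)) / 2) k := by
    refine coeff_congr ?_
    filter_upwards [Complex.reCLM.coeFn_compLp g] with x hx
    rw [hx, Complex.add_conj]
    simp
  have h2 : conj (coeff g (-k)) = coeff (fun x => conj (g x)) k := by
    have h2 : conj (2 * π : ℂ) = 2 * π := by
      rw [map_mul, Complex.conj_ofReal, Complex.conj_ofNat]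
    simp only [coeff, map_mul, ← integral_conj, map_div₀, map_one, map_pow, h2, ← wave_neg, neg_neg]
  rw [h1, h2, coeff, coeff, coeff, ← mul_add,
    ← integral_add (hint _ (Lp.memLp g)) (hint _ hconj), mul_div_assoc, ← integral_div]
  congr 2
  ext x
  ring

/-- Taking the real part symmetrizes the coefficients, which changes nothing for hermitian `a`. The
factor `2π` in `ofSeq` undoes the normalization of `waveBasis`. -/
lemma hat_ofSeq (hs : 0 < s) {a : Seq} (ha : a ∈ hermitian) (k : Fin 2 → ℤ) :
    hat (ofSeq hs a) k = ((freqNorm k ^ (-s) : ℝ) : ℂ) * a k := by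
  have h1 : ofSeq hs a =
      Complex.reCLM.compLp (waveBasis.repr.symm (((2 * π) : ℝ) • smoothing hs a)) := rfl
  have h2 : ∀ k, coeff (waveBasis.repr.symm (((2 * π) : ℝ) • smoothing hs a)) k =
      ((freqNorm k ^ (-s) : ℝ) : ℂ) * a k := by
    intro k
    rw [coeff_eq_repr, LinearIsometryEquiv.apply_symm_apply, lp.coeFn_smul, Pi.smul_apply,
      Complex.real_smul, smoothing_apply]
    push_cast
    rw [inv_mul_cancel_left₀ two_pi_ne_zero]
  rw [h1, coeff_re, h2, h2, mem_hermitian.1 ha, map_mul, Complex.conj_ofReal, Complex.conj_conj,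
    freqNorm_neg]
  ring

end Reconstruction

/-! ### Minkowski's inequality for time integrals. -/

section Integration

variable {I : Type*} {G : I → ℝ → ℂ} {L : ℝ} {p q : ℝ}

/-- The norm of an integral is at most the integral of the norm, in a finite-dimensional Euclidean
space. Working with finite `S` avoids any measurability question for `ℓ²`-valued curves. -/
lemma sum_norm_integral_sq_le (S : Finset I) (hpq : p ≤ q)
    (hG : ∀ i, IntervalIntegrable (G i) volume p q)
    (hL : ∀ᵐ τ ∂volume.restrict (Ioc p q), ∑ i ∈ S, ‖G i τ‖ ^ 2 ≤ L ^ 2) (hL0 : 0 ≤ L) :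
    ∑ i ∈ S, ‖∫ τ in p..q, G i τ‖ ^ 2 ≤ (L * (q - p)) ^ 2 := by
  let v : ℝ → EuclideanSpace ℂ S := fun τ => WithLp.toLp 2 fun i : S => G i τ
  have hv : ∀ i : S, Integrable (fun τ => v τ i) (volume.restrict (Ioc p q)) := fun i =>
    (intervalIntegrable_iff_integrableOn_Ioc_of_le hpq).1 (hG i)
  have hnorm : ∀ w : EuclideanSpace ℂ S, ‖w‖ ^ 2 = ∑ i : S, ‖w i‖ ^ 2 := fun w =>
    EuclideanSpace.norm_sq_eq w
  have hcomp : ∀ i : S, (∫ τ in Ioc p q, v τ) i = ∫ τ in p..q, G i τ := fun i => by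
    rw [eval_integral_piLp hv, intervalIntegral.integral_of_le hpq]
  have hle : ‖∫ τ in Ioc p q, v τ‖ ≤ L * (q - p) := by
    have hb : ∀ᵐ τ ∂volume.restrict (Ioc p q), ‖v τ‖ ≤ L := by
      filter_upwards [hL] with τ hτ
      refine le_of_sq_le_sq ?_ hL0
      rw [hnorm]
      refine le_trans (le_of_eq ?_) hτ
      exact Finset.sum_coe_sort S fun i => ‖G i τ‖ ^ 2
    refine (norm_integral_le_of_norm_le_const hb).trans (le_of_eq ?_)
    rw [measureReal_restrict_apply_univ, Real.volume_real_Ioc_of_le hpq]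
  have h1 := pow_le_pow_left₀ (norm_nonneg _) hle 2
  rw [hnorm] at h1
  simp only [hcomp] at h1
  rwa [Finset.sum_coe_sort S fun i => ‖∫ τ in p..q, G i τ‖ ^ 2] at h1

lemma sum_norm_sq_le_of_norm_le (a : lp (fun _ : I => ℂ) 2) (ha : ‖a‖ ≤ L) (S : Finset I) :
    ∑ i ∈ S, ‖a i‖ ^ 2 ≤ L ^ 2 := by
  have h := lp.sum_rpow_le_norm_rpow (p := 2) (by simp) a S
  simp only [ENNReal.toReal_ofNat, Real.rpow_ofNat] at h
  exact h.trans (pow_le_pow_left₀ (norm_nonneg _) ha 2)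

lemma memℓp_of_sum_norm_sq_le {a : I → ℂ} {B : ℝ} (h : ∀ S : Finset I, ∑ i ∈ S, ‖a i‖ ^ 2 ≤ B) :
    Memℓp a 2 :=
  memℓp_gen' (C := B) fun S => by simpa using h S

lemma norm_le_of_sum_norm_sq_le (a : lp (fun _ : I => ℂ) 2) (hL : 0 ≤ L)
    (h : ∀ S : Finset I, ∑ i ∈ S, ‖a i‖ ^ 2 ≤ L ^ 2) : ‖a‖ ≤ L :=
  lp.norm_le_of_forall_sum_le (by simp) hL fun S => by simpa using h S

end Integration

/-! ### Solutions of the equation versus integral curves in `ℓ²`. -/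

section Correspondence

variable {μ α s : ℝ} {θ₀ : L2} {T : ℝ} {θ : ℝ → L2}

/-- The `k`-th component of the time derivative of the unknowns `|k|^s θ̂(k)`. -/
noncomputable def rate (μ α s : ℝ) (θ : ℝ → L2) (k : Fin 2 → ℤ) (τ : ℝ) : ℂ :=
  ((-(freqNorm k ^ s / (1 + μ * freqNorm k ^ (2 * α))) : ℝ) : ℂ) * coeff (advection (θ τ)) k

lemma IsSolution.intervalIntegrable_rate (h : IsSolution μ α s θ₀ T θ) (k : Fin 2 → ℤ) {p q : ℝ}
    (hp : p ∈ Icc 0 T) (hq : q ∈ Icc 0 T) :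
    IntervalIntegrable (rate μ α s θ k) volume p q := by
  refine IntervalIntegrable.const_mul ?_ _
  rw [intervalIntegrable_iff]
  refine (h.integrable k).mono_set (uIoc_subset_uIcc.trans ?_)
  exact uIcc_subset_Icc hp hq

lemma IsSolution.component_eq (h : IsSolution μ α s θ₀ T θ) (hμ : 0 < μ) (k : Fin 2 → ℤ) {t : ℝ}
    (ht : t ∈ Icc 0 T) :
    ((freqNorm k ^ s : ℝ) : ℂ) * hat (θ t) k =
      ((freqNorm k ^ s : ℝ) : ℂ) * hat θ₀ k + ∫ τ in (0 : ℝ)..t, rate μ α s θ k τ := by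
  have h1 := h.equation t ht k
  have h2 : ((1 + μ * freqNorm k ^ (2 * α) : ℝ) : ℂ) ≠ 0 :=
    Complex.ofReal_ne_zero.2 (one_add_symbol_pos hμ k).ne'
  have h3 : ∫ τ in (0 : ℝ)..t, coeff (advection (θ τ)) k =
      -(((1 + μ * freqNorm k ^ (2 * α) : ℝ) : ℂ) * (hat (θ t) k - hat θ₀ k)) :=
    eq_neg_of_add_eq_zero_right h1
  simp only [rate]
  rw [intervalIntegral.integral_const_mul, h3, Complex.ofReal_neg, Complex.ofReal_div]
  field_simp
  ring

lemma IsSolution.component_sub (h : IsSolution μ α s θ₀ T θ) (hμ : 0 < μ) (k : Fin 2 → ℤ) {p q : ℝ}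
    (hp : p ∈ Icc 0 T) (hq : q ∈ Icc 0 T) :
    ((freqNorm k ^ s : ℝ) : ℂ) * hat (θ q) k - ((freqNorm k ^ s : ℝ) : ℂ) * hat (θ p) k =
      ∫ τ in p..q, rate μ α s θ k τ := by
  have h0 : (0 : ℝ) ∈ Icc 0 T := ⟨le_rfl, hp.1.trans hp.2⟩
  rw [h.component_eq hμ k hp, h.component_eq hμ k hq,
    ← intervalIntegral.integral_add_adjacent_intervals (h.intervalIntegrable_rate k h0 hp)
      (h.intervalIntegrable_rate k hp hq)]
  ring

/-- At almost every time the rates are the entries of `field`, of norm at most `fieldConst μ s * M ^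
2`. Partial sums allow all times `p` and `q`, even before `‖θ‖_s` is known to be finite there. -/
lemma IsSolution.exists_sum_le (h : IsSolution μ α s θ₀ T θ) (hμ : 0 < μ) (hα : 1 / 2 ≤ α)
    (hs : 1 < s) : ∃ L : ℝ, 0 ≤ L ∧ ∀ p ∈ Icc 0 T, ∀ q ∈ Icc 0 T, p ≤ q →
      ∀ S : Finset (Fin 2 → ℤ), ∑ k ∈ S, ‖((freqNorm k ^ s : ℝ) : ℂ) * hat (θ q) k -
        ((freqNorm k ^ s : ℝ) : ℂ) * hat (θ p) k‖ ^ 2 ≤ (L * (q - p)) ^ 2 := by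
  obtain ⟨M, hM⟩ := h.bounded
  refine ⟨fieldConst μ s * M ^ 2, by positivity, fun p hp q hq hpq S => ?_⟩
  simp only [h.component_sub hμ _ hp hq]
  refine sum_norm_integral_sq_le S hpq (fun k => h.intervalIntegrable_rate k hp hq) ?_
    (by positivity)
  have hsub : Ioc p q ⊆ Icc 0 T := Ioc_subset_Icc_self.trans (Icc_subset_Icc hp.1 hq.2)
  filter_upwards [ae_restrict_of_ae_restrict_of_subset hsub hM] with τ hτ
  have hfin : sobolevNorm s (θ τ) < ∞ := hτ.trans_lt ENNReal.coe_lt_top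
  have hnorm : ‖toSeq s (θ τ)‖ ≤ M := by
    rw [← enorm_toSeq hfin, enorm_eq_nnnorm] at hτ
    exact_mod_cast hτ
  have hF : ‖field hμ hα hs (toSeq s (θ τ))‖ ≤ fieldConst μ s * M ^ 2 := by
    refine ((quadraticLipschitz_field hμ hα hs).norm_le (field_zero hμ hα hs) _).trans ?_
    gcongr
  have := sum_norm_sq_le_of_norm_le _ hF S
  simpa only [rate, field_toSeq hμ hα hs hfin] using this

/-- The essential bound says nothing at a given `t`; the Lipschitz estimate started from `θ₀` does.
-/
lemma IsSolution.sobolevNorm_lt_top (h : IsSolution μ α s θ₀ T θ) (hμ : 0 < μ) (hα : 1 / 2 ≤ α)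
    (hs : 1 < s) (hθ₀ : sobolevNorm s θ₀ < ∞) {t : ℝ} (ht : t ∈ Icc 0 T) :
    sobolevNorm s (θ t) < ∞ := by
  obtain ⟨L, -, hL⟩ := h.exists_sum_le hμ hα hs
  have h0 : (0 : ℝ) ∈ Icc 0 T := ⟨le_rfl, ht.1.trans ht.2⟩
  have h1 := memℓp_of_sum_norm_sq_le (hL 0 h0 t ht ht.1)
  rw [h.initial] at h1
  rw [sobolevNorm_lt_top_iff] at hθ₀ ⊢
  convert! h1.add hθ₀ using 1
  ext k
  simp

lemma IsSolution.continuousOn_toSeq (h : IsSolution μ α s θ₀ T θ) (hμ : 0 < μ) (hα : 1 / 2 ≤ α)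
    (hs : 1 < s) (hθ₀ : sobolevNorm s θ₀ < ∞) :
    ContinuousOn (fun t => toSeq s (θ t)) (Icc 0 T) := by
  obtain ⟨L, hL0, hL⟩ := h.exists_sum_le hμ hα hs
  have key : ∀ p ∈ Icc 0 T, ∀ q ∈ Icc 0 T, p ≤ q →
      ‖toSeq s (θ q) - toSeq s (θ p)‖ ≤ L * (q - p) := by
    intro p hp q hq hpq
    refine norm_le_of_sum_norm_sq_le _ (mul_nonneg hL0 (sub_nonneg.2 hpq)) fun S => ?_
    simpa only [lp.coeFn_sub, Pi.sub_apply,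
      toSeq_apply (h.sobolevNorm_lt_top hμ hα hs hθ₀ hp),
      toSeq_apply (h.sobolevNorm_lt_top hμ hα hs hθ₀ hq)] using hL p hp q hq hpq S
  refine (LipschitzOnWith.of_dist_le_mul (K := ⟨L, hL0⟩) fun p hp q hq => ?_).continuousOn
  rw [dist_eq_norm, Real.dist_eq]
  rcases le_total p q with hpq | hpq
  · rw [norm_sub_rev, abs_sub_comm, abs_of_nonneg (sub_nonneg.2 hpq)]
    exact key p hp q hq hpq
  · rw [abs_of_nonneg (sub_nonneg.2 hpq)]
    exact key q hq p hp hpq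

lemma intervalIntegral_apply {c : ℝ → Seq} {p q : ℝ} (hc : IntervalIntegrable c volume p q)
    (k : Fin 2 → ℤ) : (∫ τ in p..q, c τ : Seq) k = ∫ τ in p..q, c τ k :=
  ((lp.evalCLM ℝ (fun _ : Fin 2 → ℤ => ℂ) 2 k).intervalIntegral_comp_comm hc).symm

lemma IsSolution.isMildSolution (h : IsSolution μ α s θ₀ T θ) (hμ : 0 < μ) (hα : 1 / 2 ≤ α)
    (hs : 1 < s) (hθ₀ : sobolevNorm s θ₀ < ∞) :
    IsMildSolution (field hμ hα hs) (toSeq s θ₀) T fun t => toSeq s (θ t) where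
  continuousOn := h.continuousOn_toSeq hμ hα hs hθ₀
  eq t ht := by
    have hcont : ContinuousOn (fun τ => field hμ hα hs (toSeq s (θ τ))) (Icc 0 t) :=
      (quadraticLipschitz_field hμ hα hs).continuous.comp_continuousOn
      ((h.continuousOn_toSeq hμ hα hs hθ₀).mono (Icc_subset_Icc_right ht.2))
    ext k
    rw [lp.coeFn_add, Pi.add_apply,
      intervalIntegral_apply (hcont.intervalIntegrable_of_Icc ht.1),
      toSeq_apply (h.sobolevNorm_lt_top hμ hα hs hθ₀ ht), toSeq_apply hθ₀,
      h.component_eq hμ k ht]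
    congr 1
    refine intervalIntegral.integral_congr fun τ hτ => ?_
    rw [uIcc_of_le ht.1] at hτ
    exact (field_toSeq hμ hα hs
      (h.sobolevNorm_lt_top hμ hα hs hθ₀ ⟨hτ.1, hτ.2.trans ht.2⟩) k).symm

/-- Conservation of the mean, the one mode that equality of the `toSeq` families does not determine.
-/
lemma IsSolution.hat_zero (h : IsSolution μ α s θ₀ T θ) (hμ : 0 < μ) (hα : 1 / 2 ≤ α)
    (hs : 1 < s) (hθ₀ : sobolevNorm s θ₀ < ∞) {t : ℝ} (ht : t ∈ Icc 0 T) :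
    hat (θ t) 0 = hat θ₀ 0 := by
  have h1 := h.equation t ht 0
  have h2 : ∫ τ in (0 : ℝ)..t, coeff (advection (θ τ)) 0 = 0 := by
    refine (intervalIntegral.integral_congr (g := fun _ => 0) fun τ hτ => ?_).trans
      intervalIntegral.integral_zero
    rw [uIcc_of_le ht.1] at hτ
    exact coeff_advection_zero hs
      (h.sobolevNorm_lt_top hμ hα hs hθ₀ ⟨hτ.1, hτ.2.trans ht.2⟩)
  rw [h2, freqNorm_zero, Real.zero_rpow (by linarith)] at h1
  simpa [sub_eq_zero] using h1

lemma IsSolution.unique {θ' : ℝ → L2} (h : IsSolution μ α s θ₀ T θ) (h' : IsSolution μ α s θ₀ T θ')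
    (hμ : 0 < μ) (hα : 1 / 2 ≤ α) (hs : 1 < s) (hθ₀ : sobolevNorm s θ₀ < ∞) :
    ∀ t ∈ Icc 0 T, θ t = θ' t := by
  intro t ht
  have h1 : toSeq s (θ t) = toSeq s (θ' t) := (h.isMildSolution hμ hα hs hθ₀).unique (quadraticLipschitz_field hμ hα hs)
    (h'.isMildSolution hμ hα hs hθ₀) t ht
  refine hat_injective fun k => ?_
  rcases eq_or_ne k 0 with rfl | hk
  · rw [h.hat_zero hμ hα hs hθ₀ ht, h'.hat_zero hμ hα hs hθ₀ ht]
  · rw [hat_eq_of_toSeq (h.sobolevNorm_lt_top hμ hα hs hθ₀ ht) hk,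
      hat_eq_of_toSeq (h'.sobolevNorm_lt_top hμ hα hs hθ₀ ht) hk]
    rw [h1]

lemma IsSolution.mono (h : IsSolution μ α s θ₀ T θ) {T' : ℝ} (hT : T' ≤ T) :
    IsSolution μ α s θ₀ T' θ where
  measurable := h.measurable.mono_set (Icc_subset_Icc_right hT)
  bounded := by
    obtain ⟨M, hM⟩ := h.bounded
    exact ⟨M, ae_restrict_of_ae_restrict_of_subset (Icc_subset_Icc_right hT) hM⟩
  initial := h.initial
  integrable k := (h.integrable k).mono_set (Icc_subset_Icc_right hT)
  equation t ht := h.equation t ⟨ht.1, ht.2.trans hT⟩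

lemma IsSolution.congr {θ' : ℝ → L2} (h : IsSolution μ α s θ₀ T θ) (hT : 0 ≤ T)
    (hθ : ∀ t ∈ Icc 0 T, θ' t = θ t) : IsSolution μ α s θ₀ T θ' where
  measurable := h.measurable.congr <| by
    filter_upwards [ae_restrict_mem measurableSet_Icc] with t ht
    exact (hθ t ht).symm
  bounded := by
    obtain ⟨M, hM⟩ := h.bounded
    refine ⟨M, ?_⟩
    filter_upwards [hM, ae_restrict_mem measurableSet_Icc] with t hM ht
    rwa [hθ t ht]
  initial := (hθ 0 ⟨le_rfl, hT⟩).trans h.initial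
  integrable k := (h.integrable k).congr_fun (fun t ht => by simp only [hθ t ht]) measurableSet_Icc
  equation t ht k := by
    rw [hθ t ht, ← h.equation t ht k]
    congr 1
    refine intervalIntegral.integral_congr fun τ hτ => ?_
    rw [uIcc_of_le ht.1] at hτ
    simp only [hθ τ ⟨hτ.1, hτ.2.trans ht.2⟩]

/-- A hermitian solution of the ordinary differential equation in `ℓ²` yields a solution of the
initial value problem. -/
lemma IsMildSolution.exists_isSolution {c : ℝ → Seq} (hμ : 0 < μ) (hα : 1 / 2 ≤ α) (hs : 1 < s)
    (hT : 0 ≤ T) (hθ₀ : sobolevNorm s θ₀ < ∞)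
    (hc : IsMildSolution (field hμ hα hs) (toSeq s θ₀) T c) (hh : ∀ t ∈ Icc 0 T, c t ∈ hermitian) :
    ∃ θ, IsSolution μ α s θ₀ T θ := by
  have hs0 : 0 < s := by linarith
  have hFc : ContinuousOn (fun τ => field hμ hα hs (c τ)) (Icc 0 T) :=
    (quadraticLipschitz_field hμ hα hs).continuous.comp_continuousOn hc.continuousOn
  have hFck : ∀ k, ContinuousOn (fun τ => field hμ hα hs (c τ) k) (Icc 0 T) := fun k =>
    (lp.evalCLM ℝ (fun _ : Fin 2 → ℤ => ℂ) 2 k).continuous.comp_continuousOn hFc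
  have hck : ∀ t ∈ Icc 0 T, ∀ k, c t k = toSeq s θ₀ k +
      ∫ τ in (0 : ℝ)..t, field hμ hα hs (c τ) k := fun t ht k => by
    rw [hc.eq t ht, lp.coeFn_add, Pi.add_apply, intervalIntegral_apply
      ((hFc.mono (Icc_subset_Icc_right ht.2)).intervalIntegrable_of_Icc ht.1)]
  -- Adding only the increment to `θ₀` keeps the mean of the data, since `ofSeq` produces mean zero.
  set θ : ℝ → L2 := fun t => θ₀ + ofSeq hs0 (c t - toSeq s θ₀) with hθ
  have hhat : ∀ t ∈ Icc 0 T, ∀ k, hat (θ t) k =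
      hat θ₀ k + ((freqNorm k ^ (-s) : ℝ) : ℂ) * (c t k - toSeq s θ₀ k) := fun t ht k => by
    rw [hθ]
    simp only
    rw [hat_add, hat_ofSeq hs0 (hermitian.sub_mem (hh t ht) (toSeq_mem_hermitian hθ₀)),
      lp.coeFn_sub, Pi.sub_apply]
  have hseq : ∀ t ∈ Icc 0 T, ∀ k, ((freqNorm k ^ s : ℝ) : ℂ) * hat (θ t) k = c t k := by
    intro t ht k
    rcases eq_or_ne k 0 with rfl | hk
    · rw [hck t ht, toSeq_apply hθ₀, freqNorm_zero, Real.zero_rpow hs0.ne']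
      simp [field_apply_zero]
    · rw [hhat t ht, mul_add, ← toSeq_apply hθ₀, ← mul_assoc, ← Complex.ofReal_mul,
        mul_comm (freqNorm k ^ s), freqNorm_rpow_neg_mul_rpow hk, Complex.ofReal_one, one_mul,
        add_sub_cancel]
  have hfin : ∀ t ∈ Icc 0 T, sobolevNorm s (θ t) < ∞ := fun t ht => by
    rw [sobolevNorm_lt_top_iff, funext (hseq t ht)]
    exact lp.memℓp (c t)
  have htoSeq : ∀ t ∈ Icc 0 T, toSeq s (θ t) = c t := fun t ht => by
    ext k
    rw [toSeq_apply (hfin t ht), hseq t ht]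
  have hadv : ∀ t ∈ Icc 0 T, ∀ k, coeff (advection (θ t)) k =
      ((-((1 + μ * freqNorm k ^ (2 * α)) * freqNorm k ^ (-s)) : ℝ) : ℂ) *
        field hμ hα hs (c t) k := fun t ht k => by
    rw [coeff_advection_eq hμ hα hs (hfin t ht), htoSeq t ht]
  refine ⟨θ, ?_, ?_, ?_, fun k => ?_, fun t ht k => ?_⟩
  · refine ContinuousOn.aestronglyMeasurable ?_ measurableSet_Icc
    exact continuousOn_const.add
      ((ofSeq hs0).continuous.comp_continuousOn (hc.continuousOn.sub continuousOn_const))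
  · obtain ⟨R, hR⟩ := isCompact_Icc.exists_bound_of_continuousOn hc.continuousOn
    refine ⟨R.toNNReal, ?_⟩
    filter_upwards [ae_restrict_mem measurableSet_Icc] with t ht
    rw [← enorm_toSeq (hfin t ht), htoSeq t ht, enorm_eq_nnnorm, ENNReal.coe_le_coe,
      ← NNReal.coe_le_coe, coe_nnnorm]
    exact (hR t ht).trans (Real.le_coe_toNNReal R)
  · rw [hθ]
    simp only
    rw [hc.initial hT, sub_self, map_zero, add_zero]
  · refine (ContinuousOn.integrableOn_compact isCompact_Icc ?_)
    exact (continuousOn_const.mul (hFck k)).congr fun t ht => hadv t ht k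
  · have h1 : ∫ τ in (0 : ℝ)..t, coeff (advection (θ τ)) k =
        ((-((1 + μ * freqNorm k ^ (2 * α)) * freqNorm k ^ (-s)) : ℝ) : ℂ) *
          ∫ τ in (0 : ℝ)..t, field hμ hα hs (c τ) k := by
      rw [← intervalIntegral.integral_const_mul]
      refine intervalIntegral.integral_congr fun τ hτ => ?_
      rw [uIcc_of_le ht.1] at hτ
      exact hadv τ ⟨hτ.1, hτ.2.trans ht.2⟩ k
    rw [h1, hhat t ht, hck t ht]
    push_cast
    ring

end Correspondence

/-! ### Local existence, continuation and blow-up. -/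

section MaximalSolution

variable {μ α s : ℝ} {θ₀ : L2} {T : ℝ}

lemma exists_isSolution (hμ : 0 < μ) (hα : 1 / 2 ≤ α) (hs : 1 < s) (hθ₀ : sobolevNorm s θ₀ < ∞) :
    ∃ θ, IsSolution μ α s θ₀ (existenceTime (fieldConst μ s) (sobolevNorm s θ₀).toNNReal) θ := by
  have hb : ‖toSeq s θ₀‖ ≤ (sobolevNorm s θ₀).toNNReal := by
    rw [← enorm_toSeq hθ₀, enorm_eq_nnnorm, ENNReal.toNNReal_coe, coe_nnnorm]
  obtain ⟨c, hc, hh⟩ := exists_hermitian_isMildSolution hμ hα hs (toSeq_mem_hermitian hθ₀) hb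
  exact hc.exists_isSolution hμ hα hs (existenceTime_pos _ _).le hθ₀ fun t _ => hh t

/-- A solution on `[0, t₀]` whose value at `t₀` has norm at most `b` extends for a time depending
only on `b`. -/
lemma IsSolution.exists_extension {θ : ℝ → L2} {t₀ : ℝ} (h : IsSolution μ α s θ₀ t₀ θ)
    (hμ : 0 < μ) (hα : 1 / 2 ≤ α) (hs : 1 < s) (hθ₀ : sobolevNorm s θ₀ < ∞) (ht₀ : 0 ≤ t₀)
    {b : ℝ≥0} (hb : sobolevNorm s (θ t₀) ≤ b) :
    ∃ θ', IsSolution μ α s θ₀ (t₀ + existenceTime (fieldConst μ s) b) θ' := by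
  have hτ := (existenceTime_pos (fieldConst μ s) b).le
  have hfin : ∀ t ∈ Icc 0 t₀, sobolevNorm s (θ t) < ∞ := fun t ht =>
    h.sobolevNorm_lt_top hμ hα hs hθ₀ ht
  have hfin₀ := hfin t₀ ⟨ht₀, le_rfl⟩
  have hb' : ‖toSeq s (θ t₀)‖ ≤ b := by
    rw [← enorm_toSeq hfin₀, enorm_eq_nnnorm] at hb
    exact_mod_cast hb
  obtain ⟨d, hd, hdh⟩ := exists_hermitian_isMildSolution hμ hα hs (toSeq_mem_hermitian hfin₀) hb'
  obtain ⟨e, he, he1, he2⟩ := (h.isMildSolution hμ hα hs hθ₀).glue ht₀ hτ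
    (quadraticLipschitz_field hμ hα hs).continuous hd
  refine he.exists_isSolution hμ hα hs (add_nonneg ht₀ hτ) hθ₀ fun t ht => ?_
  rcases le_total t t₀ with htt | htt
  · rw [he1 t htt]
    exact toSeq_mem_hermitian (hfin t ⟨ht.1, htt⟩)
  · rw [he2 t htt]
    exact hdh _

lemma IsSolution.le_maxTime {θ : ℝ → L2} (h : IsSolution μ α s θ₀ T θ) (hT : 0 < T) :
    ENNReal.ofReal T ≤ maxTime μ α s θ₀ :=
  le_sSup ⟨T, hT, ⟨θ, h⟩, rfl⟩

lemma exists_isSolution_of_lt_maxTime (h : ENNReal.ofReal T < maxTime μ α s θ₀) :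
    ∃ T', T < T' ∧ 0 < T' ∧ ∃ θ, IsSolution μ α s θ₀ T' θ := by
  obtain ⟨_, ⟨T', hT', hθ, rfl⟩, hlt⟩ := lt_sSup_iff.1 h
  exact ⟨T', (ENNReal.ofReal_lt_ofReal_iff hT').1 hlt, hT', hθ⟩

lemma exists_maximal_solution (hμ : 0 < μ) (hα : 1 / 2 ≤ α) (hs : 1 < s)
    (hθ₀ : sobolevNorm s θ₀ < ∞) :
    ∃ θ : ℝ → L2,
      (∀ T : ℝ, 0 < T → ENNReal.ofReal T < maxTime μ α s θ₀ → IsSolution μ α s θ₀ T θ) ∧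
      ∀ T : ℝ, 0 < T → ∀ θ' : ℝ → L2, IsSolution μ α s θ₀ T θ' →
        ∀ t ∈ Ico 0 T, θ' t = θ t := by
  classical
  -- The value at `t` comes from an arbitrary solution living past `t`; uniqueness makes the choice
  -- immaterial.
  let θ : ℝ → L2 := fun t =>
    if h : ∃ θ' : ℝ → L2, ∃ T, t < T ∧ IsSolution μ α s θ₀ T θ' then h.choose t else 0
  have hθ : ∀ T : ℝ, ∀ θ' : ℝ → L2, IsSolution μ α s θ₀ T θ' → ∀ t ∈ Ico 0 T, θ' t = θ t := by
    intro T θ' h' t ht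
    have h : ∃ θ' : ℝ → L2, ∃ T, t < T ∧ IsSolution μ α s θ₀ T θ' := ⟨θ', T, ht.2, h'⟩
    obtain ⟨T₁, hT₁, h₁⟩ := h.choose_spec
    have : θ t = h.choose t := dif_pos h
    rw [this]
    exact (h'.mono ht.2.le).unique (h₁.mono hT₁.le) hμ hα hs hθ₀ t ⟨ht.1, le_rfl⟩
  refine ⟨θ, fun T hT hlt => ?_, fun T _ θ' h' => hθ T θ' h'⟩
  obtain ⟨T', hTT', -, θ', h'⟩ := exists_isSolution_of_lt_maxTime hlt
  exact (h'.mono hTT'.le).congr hT.le fun t ht =>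
    (hθ T' θ' h' t ⟨ht.1, ht.2.trans_lt hTT'⟩).symm

lemma limsup_sobolevNorm_eq_top (hμ : 0 < μ) (hα : 1 / 2 ≤ α) (hs : 1 < s)
    (hθ₀ : sobolevNorm s θ₀ < ∞) {θ : ℝ → L2}
    (hθ : ∀ T : ℝ, 0 < T → ENNReal.ofReal T < maxTime μ α s θ₀ → IsSolution μ α s θ₀ T θ)
    (htop : maxTime μ α s θ₀ ≠ ∞) :
    limsup (fun t => sobolevNorm s (θ t)) (𝓝[<] (maxTime μ α s θ₀).toReal) = ∞ := by
  by_contra hne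
  obtain ⟨b, hb, -⟩ := ENNReal.lt_iff_exists_nnreal_btwn.1 (lt_top_iff_ne_top.2 hne)
  have hev := eventually_lt_of_limsup_lt hb
  set Tm := (maxTime μ α s θ₀).toReal with hTm
  have hTm' : maxTime μ α s θ₀ = ENNReal.ofReal Tm := (ENNReal.ofReal_toReal htop).symm
  have hpos : 0 < Tm := by
    obtain ⟨θ₁, h₁⟩ := exists_isSolution hμ hα hs hθ₀
    have hT := existenceTime_pos (fieldConst μ s) (sobolevNorm s θ₀).toNNReal
    have := h₁.le_maxTime hT
    rw [hTm'] at this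
    exact ENNReal.ofReal_pos.1 ((ENNReal.ofReal_pos.2 hT).trans_le this)
  have hτ := existenceTime_pos (fieldConst μ s) b
  have hlt : max 0 (Tm - existenceTime (fieldConst μ s) b) < Tm := max_lt hpos (by linarith)
  -- A time with norm below `b`, closer to `T_*` than the existence time for `b`: the restarted
  -- solution outlives `T_*`.
  obtain ⟨t₀, ht₀b, ht₀⟩ := (hev.and (Ioo_mem_nhdsLT hlt)).exists
  have ht₀pos : 0 < t₀ := (le_max_left _ _).trans_lt ht₀.1
  have hsol := hθ t₀ ht₀pos (by
    rw [hTm']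
    exact (ENNReal.ofReal_lt_ofReal_iff hpos).2 ht₀.2)
  obtain ⟨θ', h'⟩ := hsol.exists_extension hμ hα hs hθ₀ ht₀pos.le ht₀b.le
  have h1 := h'.le_maxTime (add_pos ht₀pos hτ)
  rw [hTm', ENNReal.ofReal_le_ofReal_iff hpos.le] at h1
  linarith [(le_max_right _ _).trans_lt ht₀.1]

end MaximalSolution

end RQG

theorem theorem3p1 (μ α s : ℝ) (hμ : 0 < μ) (hα : 1 / 2 ≤ α) (hs : 1 < s) :
    (∃ T : ℝ≥0 → ℝ, (∀ b, 0 < T b) ∧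
      ∀ θ₀ : RQG.L2, RQG.sobolevNorm s θ₀ < ∞ →
        ∃ θ : ℝ → RQG.L2,
          RQG.IsSolution μ α s θ₀ (T (RQG.sobolevNorm s θ₀).toNNReal) θ ∧
          ∀ θ' : ℝ → RQG.L2,
            RQG.IsSolution μ α s θ₀ (T (RQG.sobolevNorm s θ₀).toNNReal) θ' →
            ∀ t ∈ Icc 0 (T (RQG.sobolevNorm s θ₀).toNNReal), θ' t = θ t) ∧
    (∀ θ₀ : RQG.L2, RQG.sobolevNorm s θ₀ < ∞ →
      ∃ θ : ℝ → RQG.L2,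
        (∀ T : ℝ, 0 < T → ENNReal.ofReal T < RQG.maxTime μ α s θ₀ →
          RQG.IsSolution μ α s θ₀ T θ) ∧
        (∀ T : ℝ, 0 < T → ∀ θ' : ℝ → RQG.L2, RQG.IsSolution μ α s θ₀ T θ' →
          ∀ t ∈ Ico 0 T, θ' t = θ t) ∧
        (RQG.maxTime μ α s θ₀ = ∞ ∨
          limsup (fun t => RQG.sobolevNorm s (θ t))
            (𝓝[<] (RQG.maxTime μ α s θ₀).toReal) = ∞)) := by
  refine ⟨⟨RQG.existenceTime (RQG.fieldConst μ s), RQG.existenceTime_pos _, fun θ₀ hθ₀ => ?_⟩,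
    fun θ₀ hθ₀ => ?_⟩
  · obtain ⟨θ, hθ⟩ := RQG.exists_isSolution hμ hα hs hθ₀
    exact ⟨θ, hθ, fun θ' hθ' => hθ'.unique hθ hμ hα hs hθ₀⟩
  · obtain ⟨θ, hθ, huniq⟩ := RQG.exists_maximal_solution hμ hα hs hθ₀
    exact ⟨θ, hθ, huniq, or_iff_not_imp_left.2 fun htop =>
      RQG.limsup_sobolevNorm_eq_top hμ hα hs hθ₀ hθ htop⟩
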